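/- Let $\{\psi^\varepsilon\}_{0<\varepsilon\le 1}\subset L^2(\mathbb R^d;\mathbb C)$ have weak gradients $\nabla\psi^\varepsilon$ and put $$\rho^\varepsilon=|\psi^\varepsilon|^2,\qquad J^\varepsilon=\varepsilon\,\mathrm{Im}\big(\overline{\psi^\varepsilon}\,\nabla\psi^\varepsilon\big),\qquad \widehat{\psi}(\xi)=\int_{\mathbb R^d}\psi(x)e^{-ix\cdot\xi}\,dx$$ (the Fourier transform being extended to $L^2$). The Bohmian measure $\beta^\varepsilon$ is the nonnegative measure on $\mathbb R^d_x\times\mathbb R^d_p$ given by $$\langle\beta^\varepsilon,\varphi\rangle=\int_{\mathbb R^d}\rho^\varepsilon(x)\,\varphi\Big(x,\tfrac{J^\varepsilon(x)}{\rho^\varepsilon(x)}\Big)dx,\qquad \varphi\in C_0(\mathbb R^d_x\times\mathbb R^d_p),$$ and the Wigner function is $$w^\varepsilon(x,p)=\frac1{(2\pi)^d}\int_{\mathbb R^d}\psi^\varepsilon\big(x-\tfrac\varepsilon2y\big)\,\overline{\psi^\varepsilon}\big(x+\tfrac\varepsilon2y\big)\,e^{iy\cdot p}\,dy .$$ Assume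 that 1. $\psi^\varepsilon$ is uniformly bounded in $H^1_\varepsilon$: $\ \sup_{0<\varepsilon\le1}\big(\|\psi^\varepsilon\|_{L^2}+\|\varepsilon\nabla\psi^\varepsilon\|_{L^2}\big)<\infty$; 2. $\varepsilon\nabla\psi^\varepsilon$ is compact at infinity: $\ \lim_{R\to\infty}\limsup_{\varepsilon\to0_+}\int_{|x|\ge R}|\varepsilon\nabla\psi^\varepsilon(x)|^2\,dx=0$; 3. for some $\kappa>0$, $\ \sup_{0<\varepsilon\le1}\big\||\varepsilon\xi|^{\kappa+1}\widehat{\psi^\varepsilon}(\xi)\big\|_{L^2_\xi}<\infty$; 4. as $\varepsilon\to0_+$, along the full family or along a sequence $\varepsilon_n\to0_+$, $\beta^\varepsilon$ converges weak-$*$ (tested against $C_0(\mathbb R^{2d})$) to a finite nonnegative Borel measure $\beta$, and $w^\varepsilon$ converges weak-$*$ in $\mathcal S'(\mathbb R^{2d})$ to a finite nonnegative Borel measure $w$ (the Wigner measure). If $w=\beta$, then $\sqrt{\rho^\varepsilon}$ has a weak gradient in $L^2(\mathbb R^d;\mathbb R^d)$ for every $\varepsilon\in(0,1]$, and $\varepsilon\nabla\sqrt{\rho^\varepsilon}\to0$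 strongly in $L^2(\mathbb R^d)$ as $\varepsilon\to0_+$ (along the same family or sequence). -/

import Mathlib

open MeasureTheory Filter Topology Set
open scoped ENNReal ContDiff FourierTransform SchwartzMap ZeroAtInfty ComplexConjugate

noncomputable section

/-- Euclidean space `ℝ^d`. -/
abbrev Space (d : ℕ) : Type := EuclideanSpace ℝ (Fin d)

/-- `G` is the weak (distributional) gradient of `f : ℝ^d → 𝕜`: both are locally integrable and
`∫ f ∂ⱼφ = - ∫ Gⱼ φ` for every real test function `φ ∈ C_c^∞(ℝ^d)` and every `j`. -/
structure HasWeakGrad {𝕜 : Type*} [RCLike 𝕜] {d : ℕ} (f : Space d → 𝕜)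
    (G : Space d → EuclideanSpace 𝕜 (Fin d)) : Prop where
  locallyIntegrable : LocallyIntegrable f volume
  locallyIntegrable_grad : LocallyIntegrable G volume
  integral_eq : ∀ (j : Fin d) (φ : Space d → ℝ), ContDiff ℝ ∞ φ → HasCompactSupport φ →
    ∫ x, (fderiv ℝ φ x (EuclideanSpace.single j 1)) • f x = - ∫ x, φ x • G x j

/-- The norm `‖f‖_{L²} + ‖ε ∇f‖_{L²}` of `H¹_ε`, for `f` with weak gradient `G`. -/
def H1epsNorm {d : ℕ} (ε : ℝ) (f : Space d → ℂ) (G : Space d → EuclideanSpace ℂ (Fin d)) : ℝ≥0∞ :=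
  eLpNorm f 2 volume + eLpNorm (fun x => ε • G x) 2 volume

/-- The family `f^ε` is compact at infinity:
`lim_{R → ∞} limsup_{ε → 0+} ∫_{|x| ≥ R} |f^ε|² dx = 0`. -/
def CompactAtInfinity {d : ℕ} {F : Type*} [NormedAddCommGroup F] (f : ℝ → Space d → F) : Prop :=
  Tendsto (fun R : ℝ => limsup (fun ε : ℝ => ∫⁻ x in {x | R ≤ ‖x‖}, ‖f ε x‖ₑ ^ 2) (𝓝[>] (0 : ℝ)))
    atTop (𝓝 0)

/-- The Fourier transform `∫ f(x) e^{-i x·ξ} dx` on `L²(ℝ^d)`, obtained from the unitary `L²`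
Fourier transform, whose kernel is `e^{-2πi x·ξ}`, by the change of variables `ξ ↦ ξ / (2π)`. -/
def angularFourier {d : ℕ} (f : Lp (α := Space d) ℂ 2 volume) (ξ : Space d) : ℂ :=
  (𝓕 f : Lp (α := Space d) ℂ 2 volume) ((2 * Real.pi)⁻¹ • ξ)

/-- The position density `ρ = |ψ|²`. -/
def posDensity {d : ℕ} (ψ : Space d → ℂ) (x : Space d) : ℝ := ‖ψ x‖ ^ 2

/-- The current density `J = ε Im(ψ̄ ∇ψ)`, for `ψ` with weak gradient `G`. -/
def currentDensity {d : ℕ} (ε : ℝ) (ψ : Space d → ℂ) (G : Space d → EuclideanSpace ℂ (Fin d))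
    (x : Space d) : Space d :=
  WithLp.toLp 2 fun j => ε * (conj (ψ x) * G x j).im

/-- The Bohmian measure on phase space: the push-forward of `ρ dx` under `x ↦ (x, J(x) / ρ(x))`,
so that `⟨β, φ⟩ = ∫ ρ(x) φ(x, J(x) / ρ(x)) dx`. The value of `J / ρ` on the `ρ dx`-null set
`{ρ = 0}` does not matter. -/
def bohmMeasure {d : ℕ} (ε : ℝ) (ψ : Space d → ℂ) (G : Space d → EuclideanSpace ℂ (Fin d)) :
    Measure (Space d × Space d) :=
  (volume.withDensity fun x => ENNReal.ofReal (posDensity ψ x)).map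
    fun x => (x, (posDensity ψ x)⁻¹ • currentDensity ε ψ G x)

/-- The Wigner function
`w(x,p) = (2π)^{-d} ∫ ψ(x - ε y / 2) ψ̄(x + ε y / 2) e^{i y·p} dy`. -/
def wignerFun {d : ℕ} (ε : ℝ) (ψ : Space d → ℂ) (x p : Space d) : ℂ :=
  (((2 * Real.pi) ^ d)⁻¹ : ℝ) *
    ∫ y : Space d, ψ (x - (ε / 2) • y) * conj (ψ (x + (ε / 2) • y)) *
      Complex.exp (Complex.I * ((inner ℝ y p : ℝ) : ℂ))

/-- Weak-* convergence of the measures `μ^ε` to `ν` in the dual of `C₀`, as `ε` runs along `l`. -/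
def TendstoWeakStar {d : ℕ} (μ : ℝ → Measure (Space d × Space d)) (l : Filter ℝ)
    (ν : Measure (Space d × Space d)) : Prop :=
  ∀ φ : C₀(Space d × Space d, ℝ), Tendsto (fun ε => ∫ z, φ z ∂(μ ε)) l (𝓝 (∫ z, φ z ∂ν))

/-- Weak-* convergence in `𝒮'` of the phase space functions `w^ε` to the measure `ν`, as `ε` runs
along `l`. -/
def TendstoTempered {d : ℕ} (w : ℝ → Space d → Space d → ℂ) (l : Filter ℝ)
    (ν : Measure (Space d × Space d)) : Prop :=
  ∀ a : 𝓢(Space d × Space d, ℂ),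
    Tendsto (fun ε => ∫ z : Space d × Space d, a z * w ε z.1 z.2) l (𝓝 (∫ z, a z ∂ν))

end

/-!
Pointwise, the kinetic energy splits into the energy of the modulus and that of the current,
`|ε∇ψ|² = |ε∇√ρ|² + |J|² / ρ`, and the integral of `|J|² / ρ` is the second moment in `p` of the
Bohmian measure. Hence `‖ε∇√ρ‖²` is the total kinetic energy minus the Bohmian second moment, and it
tends to `0` as soon as, in the limit, the former is at most, and the latter at least, the second
moment `M` of `w = β`.

* The lower bound on the Bohmian side is lower semicontinuity of second moments under weak-*
  convergence (`TendstoWeakStar.eventually_lt_lintegral`). Together with the `H¹_ε` bound it also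
  shows that `M` is finite.
* The upper bound on the kinetic energy says that no energy is lost in the Wigner limit
  (`eventually_lintegral_deriv_sq_le`). For each `j`, the function `ε ∂ⱼψ` is replaced by its
  mollification at scale `ε h`, an average `v(x) = ∫ c(y) ψ(x - ε y) dy` of translates of `ψ` with
  weight `c = ∂ⱼη`. By the oscillation bound, `ε ∂ⱼψ` is Hölder continuous in `L²` under translations
  of size `ε` (`HasWeakPartial.lintegral_translate_sub_le`), so that the error is small for small
  `h`, uniformly in `ε`. Up to an error `O(ε)`, the localised energy `∫ χ |v|²` is the Wigner function
  tested against the Schwartz function `χ(x) |ĉ(p)|²` (`norm_localEnergy_sub_le`), whose limit is at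
  most `∫ |pⱼ|² dw` because `|ĉ(p)| ≤ |pⱼ|`. The energy where `χ ≠ 1`, far from the origin, is small by
  compactness at infinity.

That `√ρ = |ψ|` has the weak gradient `Re(ψ̄ ∇ψ) / |ψ|` (`HasWeakPartial.norm`) is obtained by
mollifying `ψ` and approximating the modulus by `√(|z|² + δ²)`.
-/

/-! ### Averages and square integrals -/

theorem eLpNorm_two_sq {α F : Type*} [MeasurableSpace α] [NormedAddCommGroup F] (μ : Measure α)
    (f : α → F) : eLpNorm f 2 μ ^ 2 = ∫⁻ x, ‖f x‖ₑ ^ 2 ∂μ := by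
  have h := eLpNorm_nnreal_pow_eq_lintegral (f := f) (μ := μ) (p := 2) (by norm_num)
  simpa using h

theorem tendsto_eLpNorm_two_zero {α ι E : Type*} [MeasurableSpace α] [NormedAddCommGroup E]
    {μ : Measure α} {l : Filter ι} {f : ι → α → E}
    (h : Tendsto (fun i => ∫⁻ x, ‖f i x‖ₑ ^ 2 ∂μ) l (𝓝 0)) :
    Tendsto (fun i => eLpNorm (f i) 2 μ) l (𝓝 0) := by
  simp_rw [← eLpNorm_two_sq] at h
  have := (ENNReal.continuous_rpow_const (y := (1 / 2 : ℝ))).continuousAt.tendsto.comp h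
  simp only [Function.comp_def] at this
  rw [ENNReal.zero_rpow_of_pos (by norm_num)] at this
  refine this.congr fun i => ?_
  rw [← ENNReal.rpow_natCast, ← ENNReal.rpow_mul]
  norm_num

theorem memLp_two_iff_lintegral {α F : Type*} [MeasurableSpace α] [NormedAddCommGroup F]
    {μ : Measure α} {f : α → F} (hf : AEStronglyMeasurable f μ) :
    MemLp f 2 μ ↔ ∫⁻ x, ‖f x‖ₑ ^ 2 ∂μ < ⊤ := by
  rw [← eLpNorm_two_sq, ENNReal.pow_lt_top_iff]
  simp [MemLp, hf]

/-- Jensen's inequality for the square: the square of an average is at most the average of the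
square. -/
theorem enorm_integral_sq_le {α F : Type*} [MeasurableSpace α] [NormedAddCommGroup F]
    [NormedSpace ℝ F] {μ : Measure α} [IsProbabilityMeasure μ] {f : α → F}
    (hf : AEStronglyMeasurable f μ) : ‖∫ x, f x ∂μ‖ₑ ^ 2 ≤ ∫⁻ x, ‖f x‖ₑ ^ 2 ∂μ := by
  rw [← eLpNorm_two_sq]
  gcongr
  calc ‖∫ x, f x ∂μ‖ₑ ≤ ∫⁻ x, ‖f x‖ₑ ∂μ := enorm_integral_le_lintegral_enorm _
    _ = eLpNorm f 1 μ := eLpNorm_one_eq_lintegral_enorm.symm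
    _ ≤ eLpNorm f 2 μ := eLpNorm_le_eLpNorm_of_exponent_le (by norm_num) hf

/-! ### Mollification -/

/-- The probability measure with density the normalised bump function `b`. -/
noncomputable def bumpMeasure {d : ℕ} (b : ContDiffBump (0 : Space d)) : Measure (Space d) :=
  volume.withDensity fun y => ENNReal.ofReal (b.normed volume y)

/-- The mollification of `g` at scale `r`: `x ↦ ∫ η(y) g(x - r y) dy`, with `η` the normalised bump
function `b`. -/
noncomputable def mollify {d : ℕ} (b : ContDiffBump (0 : Space d)) (r : ℝ) (g : Space d → ℂ)
    (x : Space d) : ℂ :=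
  ∫ y, g (x - r • y) ∂(bumpMeasure b)

section mollify
variable {d : ℕ} (b : ContDiffBump (0 : Space d))

instance : IsProbabilityMeasure (bumpMeasure b) := by
  constructor
  rw [bumpMeasure, withDensity_apply _ MeasurableSet.univ, setLIntegral_univ,
    ← ofReal_integral_eq_lintegral_ofReal b.integrable_normed
      (Eventually.of_forall fun x => b.nonneg_normed x), b.integral_normed, ENNReal.ofReal_one]

theorem mollify_eq (r : ℝ) (g : Space d → ℂ) (x : Space d) :
    mollify b r g x = ∫ y, b.normed volume y • g (x - r • y) := by
  rw [mollify, bumpMeasure, integral_withDensity_eq_integral_toReal_smul]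
  · simp_rw [ENNReal.toReal_ofReal (b.nonneg_normed _)]
  · exact b.continuous_normed.measurable.ennreal_ofReal
  · simp

theorem ae_bumpMeasure_norm_le : ∀ᵐ y ∂(bumpMeasure b), ‖y‖ ≤ b.rOut := by
  rw [bumpMeasure, ae_withDensity_iff b.continuous_normed.measurable.ennreal_ofReal]
  refine Eventually.of_forall fun y hy => ?_
  have : y ∈ Function.support (b.normed volume) := by
    intro h
    simp [h] at hy
  rw [b.support_normed_eq] at this
  simpa using (Metric.mem_ball.1 this).le

variable {g : Space d → ℂ}

theorem StronglyMeasurable.mollify (hg : StronglyMeasurable g) (r : ℝ) :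
    StronglyMeasurable (mollify b r g) := by
  unfold _root_.mollify
  apply StronglyMeasurable.integral_prod_right (f := fun x y : Space d => g (x - r • y))
  exact hg.comp_measurable (by fun_prop)

theorem enorm_mollify_sq_le (hg : StronglyMeasurable g) (r : ℝ) (x : Space d) :
    ‖mollify b r g x‖ₑ ^ 2 ≤ ∫⁻ y, ‖g (x - r • y)‖ₑ ^ 2 ∂(bumpMeasure b) :=
  enorm_integral_sq_le (hg.comp_measurable (by fun_prop)).aestronglyMeasurable

theorem lintegral_mollify_sq_le (hg : StronglyMeasurable g) (r : ℝ) :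
    ∫⁻ x, ‖mollify b r g x‖ₑ ^ 2 ≤ ∫⁻ x, ‖g x‖ₑ ^ 2 := by
  calc ∫⁻ x, ‖mollify b r g x‖ₑ ^ 2
      ≤ ∫⁻ x, ∫⁻ y, ‖g (x - r • y)‖ₑ ^ 2 ∂(bumpMeasure b) :=
        lintegral_mono fun x => enorm_mollify_sq_le b hg r x
    _ = ∫⁻ y, (∫⁻ x, ‖g (x - r • y)‖ₑ ^ 2) ∂(bumpMeasure b) := by
        apply lintegral_lintegral_swap
        exact (((hg.comp_measurable (g := fun z : Space d × Space d => z.1 - r • z.2)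
          (by fun_prop)).measurable.enorm).pow_const 2).aemeasurable
    _ = ∫⁻ y, (∫⁻ x, ‖g x‖ₑ ^ 2) ∂(bumpMeasure b) := by
        congr with y
        exact lintegral_sub_right_eq_self (fun x => ‖g x‖ₑ ^ 2) (r • y)
    _ = ∫⁻ x, ‖g x‖ₑ ^ 2 := by simp

theorem MemLp.mollify (hg : StronglyMeasurable g) (hg2 : MemLp g 2 volume) (r : ℝ) :
    MemLp (mollify b r g) 2 volume := by
  rw [memLp_two_iff_lintegral (StronglyMeasurable.mollify b hg r).aestronglyMeasurable]
  exact (lintegral_mollify_sq_le b hg r).trans_lt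
    ((memLp_two_iff_lintegral hg.aestronglyMeasurable).1 hg2)

/-- Mollification moves mass by at most the radius of the mollifier. -/
theorem lintegral_mollify_sq_outside_le (hg : StronglyMeasurable g) {r : ℝ} (hr : 0 ≤ r)
    (hr1 : r * b.rOut ≤ 1) (R : ℝ) :
    ∫⁻ x in {x | R + 1 ≤ ‖x‖}, ‖mollify b r g x‖ₑ ^ 2 ≤ ∫⁻ x in {x | R ≤ ‖x‖}, ‖g x‖ₑ ^ 2 := by
  have hm : ∀ R : ℝ, MeasurableSet {x : Space d | R ≤ ‖x‖} := fun R =>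
    measurableSet_le measurable_const measurable_norm
  set S : Set (Space d) := {x | R ≤ ‖x‖} with hS
  have hgS : StronglyMeasurable (S.indicator g) := hg.indicator (hm R)
  calc ∫⁻ x in {x | R + 1 ≤ ‖x‖}, ‖mollify b r g x‖ₑ ^ 2
      = ∫⁻ x in {x | R + 1 ≤ ‖x‖}, ‖mollify b r (S.indicator g) x‖ₑ ^ 2 := by
        refine setLIntegral_congr_fun (hm _) fun x hx => ?_
        have : mollify b r g x = mollify b r (S.indicator g) x := by
          refine integral_congr_ae ?_
          filter_upwards [ae_bumpMeasure_norm_le b] with y hy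
          rw [indicator_of_mem]
          have h1 : ‖x‖ - ‖r • y‖ ≤ ‖x - r • y‖ := norm_sub_norm_le _ _
          have h2 : ‖r • y‖ ≤ 1 := by
            rw [norm_smul, Real.norm_of_nonneg hr]
            exact (mul_le_mul_of_nonneg_left hy hr).trans hr1
          have h3 : R + 1 ≤ ‖x‖ := hx
          show R ≤ ‖x - r • y‖
          linarith
        simp only [this]
    _ ≤ ∫⁻ x, ‖mollify b r (S.indicator g) x‖ₑ ^ 2 := setLIntegral_le_lintegral _ _
    _ ≤ ∫⁻ x, ‖S.indicator g x‖ₑ ^ 2 := lintegral_mollify_sq_le b hgS r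
    _ = ∫⁻ x in S, ‖g x‖ₑ ^ 2 := by
        rw [← lintegral_indicator (hm R)]
        congr with x
        rw [← hS]
        by_cases hx : x ∈ S <;> simp [hx]

/-- The mollification error is controlled by the `L²` modulus of continuity. -/
theorem lintegral_mollify_sub_sq_le (hg : StronglyMeasurable g) {r : ℝ}
    (hgr : ∀ x, Integrable (fun y => g (x - r • y)) (bumpMeasure b)) {C : ℝ≥0∞}
    (hC : ∀ y : Space d, ‖y‖ ≤ b.rOut → ∫⁻ x, ‖g (x - r • y) - g x‖ₑ ^ 2 ≤ C) :
    ∫⁻ x, ‖mollify b r g x - g x‖ₑ ^ 2 ≤ C := by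
  calc ∫⁻ x, ‖mollify b r g x - g x‖ₑ ^ 2
      ≤ ∫⁻ x, ∫⁻ y, ‖g (x - r • y) - g x‖ₑ ^ 2 ∂(bumpMeasure b) := by
        refine lintegral_mono fun x => ?_
        have : mollify b r g x - g x = ∫ y, (g (x - r • y) - g x) ∂(bumpMeasure b) := by
          rw [integral_sub (hgr x) (integrable_const _)]
          simp [mollify]
        rw [this]
        exact enorm_integral_sq_le
          ((hg.comp_measurable (by fun_prop)).sub stronglyMeasurable_const).aestronglyMeasurable
    _ = ∫⁻ y, (∫⁻ x, ‖g (x - r • y) - g x‖ₑ ^ 2) ∂(bumpMeasure b) := by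
        apply lintegral_lintegral_swap
        have h1 : StronglyMeasurable fun z : Space d × Space d => g (z.1 - r • z.2) :=
          hg.comp_measurable (by fun_prop)
        have h2 : StronglyMeasurable fun z : Space d × Space d => g z.1 :=
          hg.comp_measurable (by fun_prop)
        exact ((h1.sub h2).measurable.enorm.pow_const 2).aemeasurable
    _ ≤ ∫⁻ y, C ∂(bumpMeasure b) := by
        refine lintegral_mono_ae ?_
        filter_upwards [ae_bumpMeasure_norm_le b] with y hy using hC y hy
    _ = C := by simp

/-- A locally integrable function can be averaged against the mollifier at every point. -/
theorem integrable_bumpMeasure (hg : LocallyIntegrable g volume) {r : ℝ} (hr : r ≠ 0)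
    (x : Space d) : Integrable (fun y => g (x - r • y)) (bumpMeasure b) := by
  rw [bumpMeasure, integrable_withDensity_iff_integrable_smul₀'
    b.continuous_normed.measurable.ennreal_ofReal.aemeasurable (by simp)]
  simp_rw [ENNReal.toReal_ofReal (b.nonneg_normed _)]
  have h1 : Integrable fun z => b.normed volume (r⁻¹ • (x - z)) • g z := by
    apply hg.integrable_smul_left_of_hasCompactSupport
    · exact b.continuous_normed.comp (by fun_prop)
    · have := b.hasCompactSupport_normed (μ := volume).comp_homeomorph
        ((Homeomorph.subLeft x).trans (Homeomorph.smulOfNeZero r⁻¹ (inv_ne_zero hr)))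
      exact this
  have h2 := (h1.comp_sub_left x).comp_smul hr
  simpa [smul_smul, hr] using h2

end mollify

/-! ### Weak partial derivatives -/

/-- `g` is the weak partial derivative `∂ⱼ f`, tested against smooth functions of compact support.
Integrability is assumed separately. -/
def HasWeakPartial {𝕜 : Type*} [RCLike 𝕜] {d : ℕ} (j : Fin d) (f g : Space d → 𝕜) : Prop :=
  ∀ φ : Space d → ℝ, ContDiff ℝ ∞ φ → HasCompactSupport φ →
    ∫ x, (fderiv ℝ φ x (EuclideanSpace.single j 1)) • f x = - ∫ x, φ x • g x

section
variable {d : ℕ} (b : ContDiffBump (0 : Space d)) {j : Fin d} {f g : Space d → ℂ}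

/-- Mollifying a weak derivative moves the derivative onto the mollifier. -/
theorem HasWeakPartial.mollify_eq (h : HasWeakPartial j f g) {r : ℝ} (hr : r ≠ 0) (x : Space d) :
    r • mollify b r g x =
      ∫ y, (fderiv ℝ (b.normed volume) y (EuclideanSpace.single j 1)) • f (x - r • y) := by
  set η := b.normed volume with hη
  have hηs : ContDiff ℝ ∞ η := b.contDiff_normed
  have hcv : ∀ F : Space d → ℂ,
      ∫ z, F (r⁻¹ • (x - z)) = |r ^ d| • ∫ y, F y := by
    intro F
    rw [integral_sub_left_eq_self (fun z => F (r⁻¹ • z)) volume x, Measure.integral_comp_smul]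
    simp
  have hφs : ContDiff ℝ ∞ fun z => η (r⁻¹ • (x - z)) := hηs.comp (by fun_prop)
  have hφc : HasCompactSupport fun z => η (r⁻¹ • (x - z)) :=
    b.hasCompactSupport_normed.comp_homeomorph
      ((Homeomorph.subLeft x).trans (Homeomorph.smulOfNeZero r⁻¹ (inv_ne_zero hr)))
  have hd : ∀ z, fderiv ℝ (fun z => η (r⁻¹ • (x - z))) z (EuclideanSpace.single j 1) =
      -(r⁻¹ * fderiv ℝ η (r⁻¹ • (x - z)) (EuclideanSpace.single j 1)) := by
    intro z
    have h1 : HasFDerivAt (fun z : Space d => r⁻¹ • (x - z))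
        (r⁻¹ • (-ContinuousLinearMap.id ℝ (Space d))) z :=
      ((hasFDerivAt_id z).const_sub x).const_smul r⁻¹
    have h2 := ((hηs.differentiable (by simp)) (r⁻¹ • (x - z))).hasFDerivAt.comp z h1
    have h3 := h2.fderiv
    simp only [Function.comp_def] at h3
    rw [h3]
    simp
  have key := h _ hφs hφc
  simp_rw [hd] at key
  have e1 := hcv fun y => (-(r⁻¹ * fderiv ℝ η y (EuclideanSpace.single j 1))) • f (x - r • y)
  have e2 := hcv fun y => η y • g (x - r • y)
  simp only [smul_smul, mul_inv_cancel₀ hr, one_smul, sub_sub_cancel] at e1 e2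
  rw [e1, e2, ← smul_neg] at key
  have hne : |r ^ d| ≠ 0 := by positivity
  have key2 := smul_right_injective ℂ hne key
  simp only [neg_smul, mul_smul, integral_neg, integral_smul, neg_inj] at key2
  rw [_root_.mollify_eq, ← key2, smul_inv_smul₀ hr]

theorem mollify_one_eq_convolution (f : Space d → ℂ) :
    mollify b 1 f = convolution f (b.normed volume)
      (ContinuousLinearMap.lsmul ℝ ℝ).flip volume := by
  ext x
  rw [mollify_eq, convolution_def, ← integral_sub_left_eq_self _ volume x]
  simp

theorem contDiff_mollify_one (hf : LocallyIntegrable f volume) : ContDiff ℝ 1 (mollify b 1 f) := by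
  rw [mollify_one_eq_convolution]
  exact b.hasCompactSupport_normed.contDiff_convolution_right _ hf b.contDiff_normed

/-- Mollification turns a weak derivative into a classical one. -/
theorem HasWeakPartial.fderiv_mollify (h : HasWeakPartial j f g)
    (hf : LocallyIntegrable f volume) (x : Space d) :
    fderiv ℝ (mollify b 1 f) x (EuclideanSpace.single j 1) = mollify b 1 g x := by
  have h1 := h.mollify_eq b one_ne_zero x
  rw [one_smul] at h1
  rw [h1, mollify_one_eq_convolution,
    (b.hasCompactSupport_normed.hasFDerivAt_convolution_right _ hf b.contDiff_normed x).fderiv,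
    convolution_precompR_apply _ hf (b.hasCompactSupport_normed.fderiv ℝ)
      (b.contDiff_normed (n := 1) |>.continuous_fderiv one_ne_zero), convolution_def,
      ← integral_sub_left_eq_self _ volume x]
  simp

end

/-! ### Approximation in `L²` -/

/-- Translations are strongly continuous in `L²`. -/
theorem tendsto_lintegral_translate_sub {d : ℕ} {g : Space d → ℂ} (hg : MemLp g 2 volume) :
    Tendsto (fun y : Space d => ∫⁻ x, ‖g (x - y) - g x‖ₑ ^ 2) (𝓝 0) (𝓝 0) := by
  let T : Space d → C(Space d, Space d) := fun y => ⟨fun x => x - y, by fun_prop⟩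
  have hT : Continuous T :=
    ContinuousMap.continuous_of_continuous_uncurry _ (by unfold Function.uncurry; simp [T]; fun_prop)
  have hTm : ∀ y, MeasurePreserving (T y) volume volume := fun y =>
    measurePreserving_sub_right volume y
  have h0 : Tendsto (fun y => Lp.compMeasurePreserving (T y) (hTm y) (hg.toLp g)) (𝓝 0)
      (𝓝 (Lp.compMeasurePreserving (T 0) (hTm 0) (hg.toLp g))) :=
    Filter.Tendsto.compMeasurePreservingLp tendsto_const_nhds (hT.tendsto 0) hTm (hTm 0) (by simp)
  rw [Lp.tendsto_Lp_iff_tendsto_eLpNorm'] at h0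
  have h1 : ∀ y, eLpNorm (⇑(Lp.compMeasurePreserving (T y) (hTm y) (hg.toLp g)) -
      ⇑(Lp.compMeasurePreserving (T 0) (hTm 0) (hg.toLp g))) 2 volume ^ 2
      = ∫⁻ x, ‖g (x - y) - g x‖ₑ ^ 2 := by
    intro y
    rw [eLpNorm_two_sq]
    refine lintegral_congr_ae ?_
    have e : ∀ y, ⇑(Lp.compMeasurePreserving (T y) (hTm y) (hg.toLp g)) =ᵐ[volume]
        fun x => g (x - y) := fun y =>
      (Lp.coeFn_compMeasurePreserving _ (hTm y)).trans
        ((hTm y).quasiMeasurePreserving.ae_eq_comp hg.coeFn_toLp)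
    filter_upwards [e y, e 0] with x h1 h2
    rw [Pi.sub_apply, h1, h2, sub_zero]
  simp_rw [← h1]
  have h2 := (ENNReal.continuous_pow 2).continuousAt.tendsto.comp h0
  rwa [zero_pow two_ne_zero] at h2

theorem tendsto_mollify {d : ℕ} {ι : Type*} {l : Filter ι} (b : ι → ContDiffBump (0 : Space d))
    (hb : Tendsto (fun i => (b i).rOut) l (𝓝 0)) {g : Space d → ℂ} (hgm : StronglyMeasurable g)
    (hg : MemLp g 2 volume) :
    Tendsto (fun i => eLpNorm (fun x => mollify (b i) 1 g x - g x) 2 volume) l (𝓝 0) := by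
  have hsq : Tendsto (fun i => ∫⁻ x, ‖mollify (b i) 1 g x - g x‖ₑ ^ 2) l (𝓝 0) := by
    rw [ENNReal.tendsto_nhds_zero]
    intro ε hε
    have h0 := (ENNReal.tendsto_nhds_zero.1 (tendsto_lintegral_translate_sub hg)) ε hε
    obtain ⟨r, hr, hr2⟩ := Metric.eventually_nhds_iff.1 h0
    filter_upwards [hb.eventually_lt_const hr] with i hi
    refine lintegral_mollify_sub_sq_le (b i) hgm
      (fun x => integrable_bumpMeasure _ (hg.locallyIntegrable (by norm_num)) one_ne_zero x) ?_
    intro y hy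
    rw [one_smul]
    exact hr2 (by simpa using hy.trans_lt hi)
  exact tendsto_eLpNorm_two_zero hsq

theorem lintegral_enorm_mul_le {α E F : Type*} [MeasurableSpace α] [NormedAddCommGroup E]
    [NormedAddCommGroup F] {μ : Measure α} {f : α → E} {g : α → F}
    (hf : AEStronglyMeasurable f μ) (hg : AEStronglyMeasurable g μ) :
    ∫⁻ x, ‖f x‖ₑ * ‖g x‖ₑ ∂μ ≤ eLpNorm f 2 μ * eLpNorm g 2 μ := by
  have h := ENNReal.lintegral_mul_le_Lp_mul_Lq μ (p := 2) (q := 2) (by constructor <;> norm_num)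
    hf.enorm hg.enorm
  rw [eLpNorm_eq_lintegral_rpow_enorm_toReal (by norm_num) (by norm_num),
    eLpNorm_eq_lintegral_rpow_enorm_toReal (by norm_num) (by norm_num)]
  simpa using h

/-! ### The weak gradient of the modulus -/

/-- The smooth approximation `√(|z|² + δ²)` of the modulus. -/
noncomputable def smoothAbs (δ : ℝ) (z : ℂ) : ℝ := √(‖z‖ ^ 2 + δ ^ 2)

section smoothAbs
variable {δ : ℝ}

theorem norm_le_smoothAbs (δ : ℝ) (z : ℂ) : ‖z‖ ≤ smoothAbs δ z :=
  Real.le_sqrt_of_sq_le (by nlinarith [sq_nonneg δ])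

theorem le_smoothAbs (δ : ℝ) (z : ℂ) : δ ≤ smoothAbs δ z :=
  Real.le_sqrt_of_sq_le (by nlinarith [sq_nonneg ‖z‖])

theorem smoothAbs_le (hδ : 0 ≤ δ) (z : ℂ) : smoothAbs δ z ≤ ‖z‖ + δ :=
  Real.sqrt_le_iff.2 ⟨by positivity, by nlinarith [norm_nonneg z]⟩

theorem abs_smoothAbs_sub_le (δ : ℝ) (z w : ℂ) : |smoothAbs δ z - smoothAbs δ w| ≤ ‖z - w‖ := by
  have key : ∀ z w : ℂ, smoothAbs δ z ≤ smoothAbs δ w + ‖z - w‖ := by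
    intro z w
    refine Real.sqrt_le_iff.2 ⟨by unfold smoothAbs; positivity, ?_⟩
    have h1 : smoothAbs δ w ^ 2 = ‖w‖ ^ 2 + δ ^ 2 := Real.sq_sqrt (by positivity)
    have h2 : ‖z‖ ≤ ‖w‖ + ‖z - w‖ := by
      simpa [add_comm] using norm_add_le w (z - w)
    have h3 := norm_le_smoothAbs δ w
    nlinarith [norm_nonneg z, norm_nonneg w, norm_nonneg (z - w)]
  rw [abs_le]
  have h1 := key z w
  have h2 := key w z
  rw [norm_sub_rev] at h2
  constructor <;> linarith

theorem continuous_smoothAbs (δ : ℝ) : Continuous (smoothAbs δ) := by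
  unfold smoothAbs; fun_prop

/-- The vector field `z / √(|z|² + δ²)` is Lipschitz. -/
theorem norm_div_smoothAbs_sub_le (hδ : 0 < δ) (z w : ℂ) :
    ‖(smoothAbs δ z)⁻¹ • z - (smoothAbs δ w)⁻¹ • w‖ ≤ 2 / δ * ‖z - w‖ := by
  have hz := le_smoothAbs δ z
  have hw := le_smoothAbs δ w
  have hz0 : 0 < smoothAbs δ z := hδ.trans_le hz
  have hw0 : 0 < smoothAbs δ w := hδ.trans_le hw
  have e : (smoothAbs δ z)⁻¹ • z - (smoothAbs δ w)⁻¹ • w =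
      (smoothAbs δ z)⁻¹ • (z - w) +
        ((smoothAbs δ z)⁻¹ * (smoothAbs δ w)⁻¹ * (smoothAbs δ w - smoothAbs δ z)) • w := by
    have : (smoothAbs δ z)⁻¹ * (smoothAbs δ w)⁻¹ * (smoothAbs δ w - smoothAbs δ z) =
        (smoothAbs δ z)⁻¹ - (smoothAbs δ w)⁻¹ := by field_simp
    rw [this, sub_smul, smul_sub]; abel
  have hinv : (smoothAbs δ z)⁻¹ ≤ δ⁻¹ := inv_anti₀ hδ hz
  rw [e]
  calc _ ≤ (smoothAbs δ z)⁻¹ * ‖z - w‖ +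
        (smoothAbs δ z)⁻¹ * (smoothAbs δ w)⁻¹ * |smoothAbs δ w - smoothAbs δ z| * ‖w‖ := by
        refine (norm_add_le _ _).trans (le_of_eq ?_)
        simp only [norm_smul, norm_mul, norm_inv, Real.norm_eq_abs, abs_of_pos hz0, abs_of_pos hw0]
    _ = (smoothAbs δ z)⁻¹ * ‖z - w‖ +
        (smoothAbs δ z)⁻¹ * |smoothAbs δ w - smoothAbs δ z| * ((smoothAbs δ w)⁻¹ * ‖w‖) := by ring
    _ ≤ δ⁻¹ * ‖z - w‖ + δ⁻¹ * ‖z - w‖ * 1 := by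
        gcongr
        · rw [norm_sub_rev z w]; exact abs_smoothAbs_sub_le δ w z
        · rw [inv_mul_le_iff₀ hw0, mul_one]
          exact norm_le_smoothAbs δ w
    _ = 2 / δ * ‖z - w‖ := by ring

theorem norm_div_smoothAbs_le (hδ : 0 < δ) (z : ℂ) : ‖(smoothAbs δ z)⁻¹ • z‖ ≤ 1 := by
  have hz0 : 0 < smoothAbs δ z := hδ.trans_le (le_smoothAbs δ z)
  rw [norm_smul, norm_inv, Real.norm_of_nonneg hz0.le, inv_mul_le_iff₀ hz0, mul_one]
  exact norm_le_smoothAbs δ z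

theorem fderiv_smoothAbs_comp {E : Type*} [NormedAddCommGroup E] [NormedSpace ℝ E] (hδ : 0 < δ)
    {F : E → ℂ} {x : E} (hF : DifferentiableAt ℝ F x) (v : E) :
    DifferentiableAt ℝ (fun x => smoothAbs δ (F x)) x ∧
    fderiv ℝ (fun x => smoothAbs δ (F x)) x v =
      inner ℝ ((smoothAbs δ (F x))⁻¹ • F x) (fderiv ℝ F x v) := by
  have hpos : 0 < ‖F x‖ ^ 2 + δ ^ 2 := by positivity
  have h1 := (hF.hasFDerivAt.norm_sq.add_const (δ ^ 2)).sqrt hpos.ne'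
  refine ⟨h1.differentiableAt, ?_⟩
  have h2 := h1.fderiv
  simp only [smoothAbs]
  rw [h2]
  simp
  ring

end smoothAbs

section
variable {d : ℕ} {j : Fin d} {f g : Space d → ℂ}

/-- The weak chain rule for `√(|f|² + δ²)`, by mollification. -/
theorem HasWeakPartial.smoothAbs (h : HasWeakPartial j f g) (hfm : StronglyMeasurable f)
    (hgm : StronglyMeasurable g) (hf : MemLp f 2 volume) (hg : MemLp g 2 volume)
    {δ : ℝ} (hδ : 0 < δ) :
    HasWeakPartial j (fun x => smoothAbs δ (f x))
      (fun x => (inner ℝ ((smoothAbs δ (f x))⁻¹ • f x) (g x) : ℝ)) := by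
  intro φ hφ hφc
  set S := _root_.smoothAbs δ with hS
  have hScont : Continuous S := continuous_smoothAbs δ
  have hS0 : ∀ z, S z ≠ 0 := fun z => (hδ.trans_le (le_smoothAbs δ z)).ne'
  let φ' : Space d → ℝ := fun x => fderiv ℝ φ x (EuclideanSpace.single j 1)
  have hφ'cont : Continuous φ' := (hφ.continuous_fderiv (by simp)).clm_apply continuous_const
  have hφ'c : HasCompactSupport φ' := hφc.fderiv_apply ℝ _
  let b : ℕ → ContDiffBump (0 : Space d) := fun n =>
    ⟨1 / (2 * ((n : ℝ) + 1)), 1 / ((n : ℝ) + 1), by positivity, by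
      rw [div_lt_div_iff_of_pos_left] <;> linarith [(n.cast_nonneg : (0 : ℝ) ≤ n)]⟩
  have hb : Tendsto (fun n => (b n).rOut) atTop (𝓝 0) := tendsto_one_div_add_atTop_nhds_zero_nat
  have hfl : LocallyIntegrable f volume := hf.locallyIntegrable (by norm_num)
  let fn : ℕ → Space d → ℂ := fun n => mollify (b n) 1 f
  let gn : ℕ → Space d → ℂ := fun n => mollify (b n) 1 g
  have hfnd : ∀ n, ContDiff ℝ 1 (fn n) := fun n => contDiff_mollify_one (b n) hfl
  have hfnm : ∀ n, StronglyMeasurable (fn n) := fun n => StronglyMeasurable.mollify _ hfm 1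
  have hgnm : ∀ n, StronglyMeasurable (gn n) := fun n => StronglyMeasurable.mollify _ hgm 1
  have hgncont : ∀ n, Continuous (gn n) := fun n => by
    have : gn n = fun x => fderiv ℝ (fn n) x (EuclideanSpace.single j 1) :=
      funext fun x => (h.fderiv_mollify (b n) hfl x).symm
    rw [this]
    exact ((hfnd n).continuous_fderiv one_ne_zero).clm_apply continuous_const
  have hf0 := tendsto_mollify b hb hfm hf
  have hg0 := tendsto_mollify b hb hgm hg
  -- the classical identity for the mollified functions
  have hn : ∀ n, ∫ x, φ' x * S (fn n x) =
      - ∫ x, φ x * inner ℝ ((S (fn n x))⁻¹ • fn n x) (gn n x) := by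
    intro n
    have hcfn := (hfnd n).continuous
    have hder : ∀ x, fderiv ℝ (fun x => S (fn n x)) x (EuclideanSpace.single j 1) =
        inner ℝ ((S (fn n x))⁻¹ • fn n x) (gn n x) := fun x => by
      rw [(fderiv_smoothAbs_comp hδ ((hfnd n).differentiable one_ne_zero x) _).2]
      congr 1
      exact h.fderiv_mollify (b n) hfl x
    have hI : Continuous fun x => inner ℝ ((S (fn n x))⁻¹ • fn n x) (gn n x) := by
      refine Continuous.inner (Continuous.smul (Continuous.inv₀ (by fun_prop) fun x => hS0 _)
        hcfn) (hgncont n)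
    have := integral_mul_fderiv_eq_neg_fderiv_mul_of_integrable (𝕜 := ℝ) (μ := volume)
      (f := φ) (g := fun x => S (fn n x)) (v := EuclideanSpace.single j 1) ?_ ?_ ?_ ?_ ?_
    · simp_rw [hder] at this
      rw [this, neg_neg]
    · exact (hφ'cont.mul (hScont.comp hcfn)).integrable_of_hasCompactSupport hφ'c.mul_right
    · simp_rw [hder]
      exact (hφ.continuous.mul hI).integrable_of_hasCompactSupport hφc.mul_right
    · exact (hφ.continuous.mul (hScont.comp hcfn)).integrable_of_hasCompactSupport hφc.mul_right
    · exact fun x _ => hφ.differentiable (by simp) x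
    · exact fun x _ =>
        (fderiv_smoothAbs_comp hδ ((hfnd n).differentiable one_ne_zero x) 0).1
  have hφ2 : MemLp φ 2 volume := hφ.continuous.memLp_of_hasCompactSupport hφc
  have hφ'2 : MemLp φ' 2 volume := hφ'cont.memLp_of_hasCompactSupport hφ'c
  have hfS : AEStronglyMeasurable (fun x => (S (f x))⁻¹ • f x) volume :=
    ((hScont.comp_stronglyMeasurable hfm).measurable.inv.stronglyMeasurable.smul
      hfm).aestronglyMeasurable
  -- passing to the limit on the left
  have hL : Tendsto (fun n => ∫ x, φ' x * S (fn n x)) atTop (𝓝 (∫ x, φ' x * S (f x))) := by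
    refine tendsto_integral_of_L1 _ (hφ'cont.aestronglyMeasurable.mul
      (hScont.comp_stronglyMeasurable hfm).aestronglyMeasurable) (Eventually.of_forall fun n =>
        (hφ'cont.mul (hScont.comp (hfnd n).continuous)).integrable_of_hasCompactSupport
          hφ'c.mul_right) ?_
    refine tendsto_of_tendsto_of_tendsto_of_le_of_le tendsto_const_nhds
      (h := fun n => eLpNorm φ' 2 volume * eLpNorm (fun x => fn n x - f x) 2 volume) ?_
      (fun _ => zero_le) ?_
    · simpa using ENNReal.Tendsto.const_mul hf0 (Or.inr hφ'2.eLpNorm_ne_top)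
    · intro n
      refine le_trans (lintegral_mono fun x => ?_)
        (lintegral_enorm_mul_le hφ'2.aestronglyMeasurable ((hfnm n).sub hfm).aestronglyMeasurable)
      change ‖φ' x * S (fn n x) - φ' x * S (f x)‖ₑ ≤ _
      rw [← mul_sub, enorm_mul]
      gcongr
      rw [← ofReal_norm, ← ofReal_norm]
      exact ENNReal.ofReal_le_ofReal (abs_smoothAbs_sub_le δ _ _)
  -- passing to the limit on the right
  have hR : Tendsto (fun n => ∫ x, φ x * inner ℝ ((S (fn n x))⁻¹ • fn n x) (gn n x)) atTop
      (𝓝 (∫ x, φ x * inner ℝ ((S (f x))⁻¹ • f x) (g x))) := by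
    refine tendsto_integral_of_L1 _ (hφ.continuous.aestronglyMeasurable.mul
      (hfS.inner hg.aestronglyMeasurable)) (Eventually.of_forall fun n => ?_) ?_
    · refine Continuous.integrable_of_hasCompactSupport (hφ.continuous.mul ?_) hφc.mul_right
      exact Continuous.inner (Continuous.smul (Continuous.inv₀
        (hScont.comp (hfnd n).continuous) fun x => hS0 _) (hfnd n).continuous) (hgncont n)
    obtain ⟨M, hM⟩ := hφ.continuous.bounded_above_of_compact_support hφc
    refine tendsto_of_tendsto_of_tendsto_of_le_of_le tendsto_const_nhds
      (h := fun n => eLpNorm φ 2 volume * eLpNorm (fun x => gn n x - g x) 2 volume +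
        ENNReal.ofReal (M * (2 / δ)) *
          (eLpNorm g 2 volume * eLpNorm (fun x => fn n x - f x) 2 volume)) ?_
      (fun _ => zero_le) ?_
    · have h1 := ENNReal.Tendsto.const_mul hg0 (Or.inr hφ2.eLpNorm_ne_top)
      have h2 := ENNReal.Tendsto.const_mul (ENNReal.Tendsto.const_mul hf0
        (Or.inr hg.eLpNorm_ne_top)) (Or.inr (ENNReal.ofReal_ne_top (r := M * (2 / δ))))
      simpa using h1.add h2
    · intro n
      refine le_trans (lintegral_mono (g := fun x => ‖φ x‖ₑ * ‖gn n x - g x‖ₑ +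
          ENNReal.ofReal (M * (2 / δ)) * (‖g x‖ₑ * ‖fn n x - f x‖ₑ)) fun x => ?_) ?_
      · have e : φ x * inner ℝ ((S (fn n x))⁻¹ • fn n x) (gn n x) -
            φ x * inner ℝ ((S (f x))⁻¹ • f x) (g x) =
            φ x * inner ℝ ((S (fn n x))⁻¹ • fn n x) (gn n x - g x) +
            φ x * inner ℝ ((S (fn n x))⁻¹ • fn n x - (S (f x))⁻¹ • f x) (g x) := by
          rw [inner_sub_right, inner_sub_left]; ring
        change ‖_ - φ x * inner ℝ ((S (f x))⁻¹ • f x) (g x)‖ₑ ≤ _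
        rw [e]
        refine (enorm_add_le _ _).trans (add_le_add ?_ ?_)
        · rw [enorm_mul]
          gcongr
          rw [← ofReal_norm, ← ofReal_norm]
          refine ENNReal.ofReal_le_ofReal ((norm_inner_le_norm _ _).trans ?_)
          exact mul_le_of_le_one_left (norm_nonneg _) (norm_div_smoothAbs_le hδ _)
        · simp only [← ofReal_norm]
          have hM0 : 0 ≤ M := (norm_nonneg _).trans (hM 0)
          rw [← ENNReal.ofReal_mul (norm_nonneg _), ← ENNReal.ofReal_mul (by positivity)]
          refine ENNReal.ofReal_le_ofReal ?_
          rw [norm_mul]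
          calc _ ≤ M * ((2 / δ * ‖fn n x - f x‖) * ‖g x‖) := by
                gcongr
                · exact hM x
                · refine (norm_inner_le_norm _ _).trans ?_
                  gcongr
                  exact norm_div_smoothAbs_sub_le hδ _ _
            _ = _ := by ring
      · have hm1 : Measurable fun x => ‖φ x‖ₑ * ‖gn n x - g x‖ₑ :=
          hφ.continuous.measurable.enorm.mul ((hgnm n).sub hgm).measurable.enorm
        rw [lintegral_add_left hm1, lintegral_const_mul' _ _ ENNReal.ofReal_ne_top]
        refine add_le_add ?_ (mul_le_mul' le_rfl ?_)
        · exact lintegral_enorm_mul_le hφ2.aestronglyMeasurable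
            ((hgnm n).sub hgm).aestronglyMeasurable
        · exact lintegral_enorm_mul_le hg.aestronglyMeasurable
            ((hfnm n).sub hfm).aestronglyMeasurable
  exact tendsto_nhds_unique (hL.congr hn) hR.neg

/-- The modulus of an `H¹` function has the weak derivative `Re(f̄ ∂ⱼf) / |f|`, which is `0` by
convention where `f` vanishes. -/
theorem HasWeakPartial.norm (h : HasWeakPartial j f g) (hfm : StronglyMeasurable f)
    (hgm : StronglyMeasurable g) (hf : MemLp f 2 volume) (hg : MemLp g 2 volume) :
    HasWeakPartial j (fun x => ‖f x‖) (fun x => (inner ℝ (‖f x‖⁻¹ • f x) (g x) : ℝ)) := by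
  intro φ hφ hφc
  let φ' : Space d → ℝ := fun x => fderiv ℝ φ x (EuclideanSpace.single j 1)
  have hφ'cont : Continuous φ' := (hφ.continuous_fderiv (by simp)).clm_apply continuous_const
  have hφ'c : HasCompactSupport φ' := hφc.fderiv_apply ℝ _
  have hφ2 : MemLp φ 2 volume := hφ.continuous.memLp_of_hasCompactSupport hφc
  have hφ'2 : MemLp φ' 2 volume := hφ'cont.memLp_of_hasCompactSupport hφ'c
  let δ : ℕ → ℝ := fun n => 1 / ((n : ℝ) + 1)
  have hδ : ∀ n, 0 < δ n := fun n => by positivity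
  have hδ1 : ∀ n, δ n ≤ 1 := fun n => by
    rw [div_le_one (by positivity)]; linarith [(n.cast_nonneg : (0 : ℝ) ≤ n)]
  have hδ0 : Tendsto δ atTop (𝓝 0) := tendsto_one_div_add_atTop_nhds_zero_nat
  have hSm : ∀ n, StronglyMeasurable fun x => _root_.smoothAbs (δ n) (f x) := fun n =>
    (continuous_smoothAbs _).comp_stronglyMeasurable hfm
  have hlim : ∀ z : ℂ, Tendsto (fun n => _root_.smoothAbs (δ n) z) atTop (𝓝 ‖z‖) := by
    intro z
    have : Continuous fun t : ℝ => _root_.smoothAbs t z := by unfold _root_.smoothAbs; fun_prop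
    simpa [_root_.smoothAbs, Function.comp_def] using (this.tendsto 0).comp hδ0
  have hL : Tendsto (fun n => ∫ x, φ' x • _root_.smoothAbs (δ n) (f x)) atTop
      (𝓝 (∫ x, φ' x • ‖f x‖)) := by
    refine tendsto_integral_of_dominated_convergence (fun x => ‖φ' x‖ * ‖f x‖ + ‖φ' x‖)
      (fun n => hφ'cont.aestronglyMeasurable.smul (hSm n).aestronglyMeasurable) ?_
      (fun n => Eventually.of_forall fun x => ?_) (Eventually.of_forall fun x => ?_)
    · exact (hφ'2.norm.integrable_mul hf.norm).add
        (hφ'cont.integrable_of_hasCompactSupport hφ'c).norm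
    · rw [norm_smul, Real.norm_of_nonneg ((hδ n).le.trans (le_smoothAbs _ _))]
      have := smoothAbs_le (hδ n).le (f x)
      nlinarith [norm_nonneg (φ' x), hδ1 n]
    · exact (hlim _).const_smul _
  have hR : Tendsto (fun n => ∫ x, φ x •
        (inner ℝ ((_root_.smoothAbs (δ n) (f x))⁻¹ • f x) (g x) : ℝ)) atTop
      (𝓝 (∫ x, φ x • (inner ℝ (‖f x‖⁻¹ • f x) (g x) : ℝ))) := by
    refine tendsto_integral_of_dominated_convergence (fun x => ‖φ x‖ * ‖g x‖)
      (fun n => hφ.continuous.aestronglyMeasurable.smul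
        ((((hSm n).measurable.inv.stronglyMeasurable.smul hfm).aestronglyMeasurable).inner
          hgm.aestronglyMeasurable)) ?_
      (fun n => Eventually.of_forall fun x => ?_) (Eventually.of_forall fun x => ?_)
    · exact hφ2.norm.integrable_mul hg.norm
    · rw [norm_smul]
      gcongr
      refine (norm_inner_le_norm _ _).trans ?_
      exact mul_le_of_le_one_left (norm_nonneg _) (norm_div_smoothAbs_le (hδ n) _)
    · by_cases hx : f x = 0
      · simp [hx]
      · refine Tendsto.const_smul (Tendsto.inner (Tendsto.smul ?_ tendsto_const_nhds)
          tendsto_const_nhds) _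
        exact (hlim _).inv₀ (norm_ne_zero_iff.2 hx)
  exact tendsto_nhds_unique (hL.congr fun n => h.smoothAbs hfm hgm hf hg (hδ n) φ hφ hφc) hR.neg

end

/-! ### Fourier multipliers on `L²` and the oscillation bound -/

section
variable {d : ℕ}

/-- The complex Schwartz function given by a real test function. -/
noncomputable def testSchwartz {φ : Space d → ℝ} (hφ : ContDiff ℝ ∞ φ)
    (hc : HasCompactSupport φ) : 𝓢(Space d, ℂ) :=
  HasCompactSupport.toSchwartzMap (f := fun x => (φ x : ℂ))
    (hc.comp_left (g := fun t : ℝ => (t : ℂ)) Complex.ofReal_zero)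
    (Complex.ofRealCLM.contDiff.comp hφ)

theorem testSchwartz_apply {φ : Space d → ℝ} (hφ : ContDiff ℝ ∞ φ)
    (hc : HasCompactSupport φ) (x : Space d) : testSchwartz hφ hc x = φ x := rfl

/-- A function `g ∈ L²` which acts on test functions as the Fourier multiplier `m` applied to `f`
has Fourier transform `m 𝓕 f`. -/
theorem fourier_eq_of_integral_eq (f g F : Lp (α := Space d) ℂ 2 volume) (m : Space d → ℂ)
    (hF : F =ᵐ[volume] fun ξ => m ξ * (𝓕 f : Lp (α := Space d) ℂ 2 volume) ξ)
    (h : ∀ (φ : Space d → ℝ) (hφ : ContDiff ℝ ∞ φ) (hc : HasCompactSupport φ),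
      ∃ s : 𝓢(Space d, ℂ), (∀ ξ, 𝓕⁻ s ξ = m ξ * 𝓕⁻ (testSchwartz hφ hc) ξ) ∧
        ∫ x, φ x • g x = ∫ x, s x • f x) :
    𝓕 g = F := by
  have hg : g = 𝓕⁻ F := by
    refine Lp.ext (ae_eq_of_integral_contDiff_smul_eq
      ((Lp.memLp g).locallyIntegrable (by norm_num))
      ((Lp.memLp (𝓕⁻ F)).locallyIntegrable (by norm_num)) fun φ hφ hc => ?_)
    obtain ⟨s, hs, hgs⟩ := h φ hφ hc
    rw [hgs]
    have e1 := congrArg (fun T : 𝓢'(Space d, ℂ) => T (testSchwartz hφ hc))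
      (Lp.fourierInv_toTemperedDistribution_eq F)
    have e2 := congrArg (fun T : 𝓢'(Space d, ℂ) => T (𝓕⁻ s))
      (Lp.fourier_toTemperedDistribution_eq f)
    simp only [TemperedDistribution.fourierInv_apply, TemperedDistribution.fourier_apply,
      Lp.toTemperedDistribution_apply, FourierTransform.fourier_fourierInv_eq] at e1 e2
    rw [e2]
    trans ∫ x, (testSchwartz hφ hc) x • (𝓕⁻ F : Lp (α := Space d) ℂ 2 volume) x
    · rw [← e1]
      refine integral_congr_ae ?_
      filter_upwards [hF] with ξ hξ
      rw [hξ, hs]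
      simp only [smul_eq_mul]
      ring
    · refine integral_congr_ae (Eventually.of_forall fun x => ?_)
      simp [testSchwartz_apply]
  rw [hg, FourierTransform.fourier_fourierInv_eq]

/-- The Fourier transform of a weak derivative. -/
theorem HasWeakPartial.fourier_eq {j : Fin d} {f g F : Lp (α := Space d) ℂ 2 volume}
    (h : HasWeakPartial j f g)
    (hF : F =ᵐ[volume] fun ξ => (2 * Real.pi * Complex.I * (ξ j : ℂ)) *
      (𝓕 f : Lp (α := Space d) ℂ 2 volume) ξ) : 𝓕 g = F := by
  refine fourier_eq_of_integral_eq f g F _ hF fun φ hφ hc => ?_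
  have hd : ∀ x, LineDeriv.lineDerivOp (EuclideanSpace.single j (1 : ℝ)) (testSchwartz hφ hc) x =
      ((fderiv ℝ φ x (EuclideanSpace.single j 1) : ℝ) : ℂ) := by
    intro x
    rw [SchwartzMap.lineDerivOp_apply_eq_fderiv]
    have h1 : HasFDerivAt (fun x => (φ x : ℂ)) (Complex.ofRealCLM.comp (fderiv ℝ φ x)) x :=
      Complex.ofRealCLM.hasFDerivAt.comp x ((hφ.differentiable (by simp)) x).hasFDerivAt
    have h2 : fderiv ℝ (testSchwartz hφ hc) x = _ := h1.fderiv
    rw [h2]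
    simp
  refine ⟨-(LineDeriv.lineDerivOp (EuclideanSpace.single j (1 : ℝ)) (testSchwartz hφ hc)), ?_, ?_⟩
  · intro ξ
    have : (fun y : Space d => (inner ℝ y (EuclideanSpace.single j (1 : ℝ)) : ℝ)).HasTemperateGrowth :=
      by fun_prop
    rw [FourierTransform.fourierInv_neg, neg_apply,
      SchwartzMap.fourierInv_lineDerivOp_eq, smul_apply,
      SchwartzMap.smulLeftCLM_apply_apply this]
    simp [EuclideanSpace.inner_single_right]
    ring
  · have := h φ hφ hc
    rw [eq_neg_iff_add_eq_zero, add_comm, ← eq_neg_iff_add_eq_zero] at this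
    rw [this, ← integral_neg]
    refine integral_congr_ae (Eventually.of_forall fun x => ?_)
    simp [hd]

/-- The Fourier transform of a translate. -/
theorem fourier_translate_eq {g gy F : Lp (α := Space d) ℂ 2 volume} (y : Space d)
    (hgy : gy =ᵐ[volume] fun x => g (x - y))
    (hF : F =ᵐ[volume] fun ξ => Complex.exp (Complex.I * ((-(2 * Real.pi * inner ℝ y ξ) : ℝ) : ℂ)) *
      (𝓕 g : Lp (α := Space d) ℂ 2 volume) ξ) : 𝓕 gy = F := by
  refine fourier_eq_of_integral_eq g gy F _ hF fun φ hφ hc => ?_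
  refine ⟨(testSchwartz hφ hc).compSubConstCLM ℂ (-y), ?_, ?_⟩
  · intro ξ
    rw [SchwartzMap.fourierInv_coe, SchwartzMap.fourierInv_coe, Real.fourierInv_eq',
      Real.fourierInv_eq', ← integral_sub_right_eq_self _ y, ← integral_const_mul]
    refine integral_congr_ae (Eventually.of_forall fun x => ?_)
    simp only [SchwartzMap.compSubConstCLM_apply, sub_neg_eq_add, sub_add_cancel, smul_eq_mul,
      ← mul_assoc, ← Complex.exp_add, inner_sub_left]
    congr 2
    push_cast
    ring
  · calc ∫ x, φ x • gy x = ∫ x, φ x • g (x - y) := by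
          refine integral_congr_ae ?_
          filter_upwards [hgy] with x hx
          rw [hx]
      _ = ∫ x, φ (x + y) • g x := by
          rw [← integral_sub_right_eq_self (fun x => φ (x + y) • g x) y]
          simp
      _ = _ := by
          refine integral_congr_ae (Eventually.of_forall fun x => ?_)
          simp [SchwartzMap.compSubConstCLM_apply, testSchwartz_apply]

/-- Interpolation between the trivial bound and the Lipschitz bound for `e^{iθ} - 1`. -/
theorem norm_exp_sub_one_sq_mul_le {κ : ℝ} (hκ : 0 < κ) {θ Y t : ℝ} (hY : 0 ≤ Y) (ht : 0 ≤ t)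
    (hθ : |θ| ≤ Y * t) :
    ‖Complex.exp (Complex.I * (θ : ℂ)) - 1‖ ^ 2 * t ^ 2 ≤
      4 * Y ^ (2 * min κ 1) * (1 + t ^ (2 * (κ + 1))) := by
  set s := min κ 1 with hs
  have hs0 : 0 < s := lt_min hκ one_pos
  have hs1 : s ≤ 1 := min_le_right _ _
  have hsκ : s ≤ κ := min_le_left _ _
  have h1 : ‖Complex.exp (Complex.I * (θ : ℂ)) - 1‖ ≤ 2 * (Y * t) ^ s := by
    have hYt : 0 ≤ Y * t := by positivity
    rcases le_total 1 (Y * t) with h | h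
    · have h2 : ‖Complex.exp (Complex.I * (θ : ℂ)) - 1‖ ≤ 2 := by
        refine (norm_sub_le _ _).trans ?_
        rw [Complex.norm_exp_I_mul_ofReal]; norm_num
      have := Real.one_le_rpow h hs0.le
      linarith
    · have h2 := Real.norm_exp_I_mul_ofReal_sub_one_le (x := θ)
      have h3 : Y * t ≤ (Y * t) ^ s := by
        rcases hYt.eq_or_lt with h0 | h0
        · rw [← h0, Real.zero_rpow hs0.ne']
        · simpa using Real.rpow_le_rpow_of_exponent_ge h0 h hs1
      have h4 : 0 ≤ (Y * t) ^ s := by positivity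
      rw [Real.norm_eq_abs] at h2
      linarith
  have h2 : t ^ (2 * (s + 1)) ≤ 1 + t ^ (2 * (κ + 1)) := by
    rcases le_total t 1 with h | h
    · have h3 := Real.rpow_le_one ht h (by positivity : 0 ≤ 2 * (s + 1))
      have h4 : 0 ≤ t ^ (2 * (κ + 1)) := by positivity
      linarith
    · have := Real.rpow_le_rpow_of_exponent_le h (by linarith : 2 * (s + 1) ≤ 2 * (κ + 1))
      linarith
  calc _ ≤ (2 * (Y * t) ^ s) ^ 2 * t ^ 2 := by gcongr
    _ = 4 * Y ^ (2 * s) * t ^ (2 * (s + 1)) := by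
        rw [Real.mul_rpow hY ht, mul_comm 2 s, Real.rpow_mul hY,
          show 2 * (s + 1) = s * 2 + 2 by ring,
          Real.rpow_add_of_nonneg ht (by positivity) (by norm_num), Real.rpow_mul ht]
        simp only [Real.rpow_two]
        ring
    _ ≤ _ := by gcongr

/-- The change of variables from the unitary to the angular Fourier transform has Jacobian
`(2π)^d ≥ 1`, so that a bound on the latter is one on the former. -/
theorem lintegral_fourier_le_angularFourier (f : Lp (α := Space d) ℂ 2 volume) (ε p : ℝ) :
    ∫⁻ ξ, ‖(‖(2 * Real.pi * ε) • ξ‖ ^ p) • (𝓕 f : Lp (α := Space d) ℂ 2 volume) ξ‖ₑ ^ 2 ≤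
      eLpNorm (fun ξ : Space d => ‖ε • ξ‖ ^ p • angularFourier f ξ) 2 volume ^ 2 := by
  rw [eLpNorm_two_sq]
  have hpi : (2 * Real.pi)⁻¹ ≠ 0 := by positivity
  set F : Space d → ℝ≥0∞ := fun ξ => ‖(‖(2 * Real.pi * ε) • ξ‖ ^ p) •
      (𝓕 f : Lp (α := Space d) ℂ 2 volume) ξ‖ₑ ^ 2 with hF
  have h1 : ∀ ξ : Space d, ‖‖ε • ξ‖ ^ p • angularFourier f ξ‖ₑ ^ 2 = F ((2 * Real.pi)⁻¹ • ξ) := by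
    intro ξ
    have : (2 * Real.pi * ε) • (2 * Real.pi)⁻¹ • ξ = ε • ξ := by
      rw [smul_smul]
      congr 1
      field_simp
    simp only [hF, this, angularFourier]
  have h2 := lintegral_map_equiv (μ := volume) F (Homeomorph.smulOfNeZero (2 * Real.pi)⁻¹ hpi
    (α := Space d)).toMeasurableEquiv
  have h3 : Measure.map (Homeomorph.smulOfNeZero (2 * Real.pi)⁻¹ hpi
      (α := Space d)).toMeasurableEquiv volume =
      ENNReal.ofReal |(((2 * Real.pi)⁻¹) ^ Module.finrank ℝ (Space d))⁻¹| • volume :=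
    Measure.map_addHaar_smul volume hpi
  rw [h3, lintegral_smul_measure] at h2
  simp_rw [h1]
  change _ ≤ ∫⁻ ξ, F ((Homeomorph.smulOfNeZero (2 * Real.pi)⁻¹ hpi
    (α := Space d)).toMeasurableEquiv ξ)
  rw [← h2, smul_eq_mul]
  refine le_mul_of_one_le_left (zero_le) ?_
  rw [ENNReal.one_le_ofReal, inv_pow, inv_inv, abs_of_nonneg (by positivity)]
  exact one_le_pow₀ (by linarith [Real.pi_gt_three])

/-- If `|εξ|^{κ+1} f̂` is bounded in `L²`, then the scaled derivative `ε ∂ⱼf` is Hölder continuous in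
`L²` under translations of size `ε`. -/
theorem HasWeakPartial.lintegral_translate_sub_le {j : Fin d}
    {f g : Lp (α := Space d) ℂ 2 volume} (h : HasWeakPartial j f g) {ε κ : ℝ} (hε : 0 < ε)
    (hκ : 0 < κ) (hfin : eLpNorm (fun ξ : Space d => ‖ε • ξ‖ ^ (κ + 1) • angularFourier f ξ) 2
      volume < ⊤) (y : Space d) :
    ∫⁻ x, ‖ε • g (x - ε • y) - ε • g x‖ₑ ^ 2 ≤ ENNReal.ofReal (4 * ‖y‖ ^ (2 * min κ 1)) *
      (eLpNorm f 2 volume ^ 2 +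
        eLpNorm (fun ξ : Space d => ‖ε • ξ‖ ^ (κ + 1) • angularFourier f ξ) 2 volume ^ 2) := by
  set A := eLpNorm (fun ξ : Space d => ‖ε • ξ‖ ^ (κ + 1) • angularFourier f ξ) 2 volume with hA
  have hAle := lintegral_fourier_le_angularFourier f ε (κ + 1)
  rw [← hA] at hAle
  set F : Lp (α := Space d) ℂ 2 volume := 𝓕 f with hFdef
  let t : Space d → ℝ := fun ξ => ‖(2 * Real.pi * ε) • ξ‖
  have htm : Measurable t := by fun_prop
  have ht0 : ∀ ξ, 0 ≤ t ξ := fun ξ => norm_nonneg _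
  have hFm : StronglyMeasurable F := Lp.stronglyMeasurable F
  have hF2 : ∫⁻ ξ, ‖F ξ‖ₑ ^ 2 = eLpNorm f 2 volume ^ 2 := by
    rw [← eLpNorm_two_sq, ← Lp.enorm_def, ← Lp.enorm_def]
    simp only [enorm_eq_nnnorm, hFdef]
    congr 2
    exact NNReal.eq (Lp.norm_fourier_eq f)
  have hsum : ∫⁻ ξ, (‖F ξ‖ₑ ^ 2 + ‖(t ξ ^ (κ + 1)) • F ξ‖ₑ ^ 2) ≤ eLpNorm f 2 volume ^ 2 + A ^ 2 := by
    rw [lintegral_add_left (hFm.measurable.enorm.pow_const 2), hF2]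
    gcongr
  have hpt : ∀ (c : ℝ) (z : ℂ) (ξ : Space d), 0 ≤ c → ‖z‖ ^ 2 ≤ c * (1 + t ξ ^ (2 * (κ + 1))) →
      ‖z * F ξ‖ₑ ^ 2 ≤ ENNReal.ofReal c * (‖F ξ‖ₑ ^ 2 + ‖(t ξ ^ (κ + 1)) • F ξ‖ₑ ^ 2) := by
    intro c z ξ hc hz
    simp only [← ofReal_norm]
    rw [← ENNReal.ofReal_pow (norm_nonneg _), ← ENNReal.ofReal_pow (norm_nonneg _),
      ← ENNReal.ofReal_pow (norm_nonneg _), ← ENNReal.ofReal_add (by positivity) (by positivity),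
      ← ENNReal.ofReal_mul hc]
    refine ENNReal.ofReal_le_ofReal ?_
    have e : (t ξ ^ (κ + 1)) ^ 2 = t ξ ^ (2 * (κ + 1)) := by
      rw [mul_comm, Real.rpow_mul (ht0 ξ), Real.rpow_two]
    rw [norm_mul, norm_smul, mul_pow, mul_pow, Real.norm_eq_abs, sq_abs, e]
    nlinarith [sq_nonneg ‖F ξ‖]
  have hξ : ∀ ξ : Space d, |2 * Real.pi * ε * ξ j| ≤ t ξ := by
    intro ξ
    have h1 := PiLp.norm_apply_le ((2 * Real.pi * ε) • ξ) j
    simpa [t] using h1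
  -- the Fourier transform of `g`
  have hFg : MemLp (fun ξ => (2 * Real.pi * Complex.I * (ξ j : ℂ)) * F ξ) 2 volume := by
    have hm : Measurable fun ξ : Space d => (2 * Real.pi * Complex.I * (ξ j : ℂ)) := by fun_prop
    have hm2 : AEStronglyMeasurable
        (fun ξ => (2 * Real.pi * Complex.I * (ξ j : ℂ)) * F ξ) volume :=
      (hm.stronglyMeasurable.mul hFm).aestronglyMeasurable
    rw [memLp_two_iff_lintegral hm2]
    refine lt_of_le_of_lt (lintegral_mono fun ξ => hpt (ε⁻¹ ^ 2) _ ξ (by positivity) ?_)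
      (lt_of_le_of_lt (lintegral_const_mul' _ _ ENNReal.ofReal_ne_top).le
        (ENNReal.mul_lt_top ENNReal.ofReal_lt_top (hsum.trans_lt ?_)))
    · have h1 : ‖2 * Real.pi * Complex.I * (ξ j : ℂ)‖ = ε⁻¹ * |2 * Real.pi * ε * ξ j| := by
        simp [abs_mul, abs_of_pos hε, abs_of_pos Real.pi_pos]
        field_simp
      have h2 : t ξ ^ 2 ≤ 1 + t ξ ^ (2 * (κ + 1)) := by
        have h4 : 0 ≤ t ξ ^ (2 * (κ + 1)) := Real.rpow_nonneg (ht0 ξ) _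
        rcases le_total (t ξ) 1 with h | h
        · nlinarith [ht0 ξ]
        · have := Real.rpow_le_rpow_of_exponent_le h (by linarith : (2 : ℝ) ≤ 2 * (κ + 1))
          rw [Real.rpow_two] at this
          linarith
      rw [h1, mul_pow]
      gcongr
      exact (pow_le_pow_left₀ (abs_nonneg _) (hξ ξ) 2).trans h2
    · exact ENNReal.add_lt_top.2 ⟨ENNReal.pow_lt_top (Lp.memLp f).eLpNorm_lt_top,
        ENNReal.pow_lt_top hfin⟩
  have e1 : 𝓕 g = hFg.toLp _ := h.fourier_eq hFg.coeFn_toLp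
  -- the Fourier transform of the translate
  have hgy : MemLp (fun x => g (x - ε • y)) 2 volume :=
    (Lp.memLp g).comp_measurePreserving (measurePreserving_sub_right volume (ε • y))
  let m : Space d → ℂ := fun ξ =>
    Complex.exp (Complex.I * ((-(2 * Real.pi * inner ℝ (ε • y) ξ) : ℝ) : ℂ))
  have hmm : Measurable m := by fun_prop
  have hFy : MemLp (fun ξ => m ξ * (𝓕 g : Lp (α := Space d) ℂ 2 volume) ξ) 2 volume := by
    refine (Lp.memLp (𝓕 g)).of_le (hmm.stronglyMeasurable.mul
      (Lp.stronglyMeasurable _)).aestronglyMeasurable (Eventually.of_forall fun ξ => ?_)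
    rw [norm_mul, Complex.norm_exp_I_mul_ofReal, one_mul]
  have e2 : 𝓕 (hgy.toLp _) = hFy.toLp _ :=
    fourier_translate_eq (ε • y) hgy.coeFn_toLp hFy.coeFn_toLp
  have e3 : ∫⁻ x, ‖ε • g (x - ε • y) - ε • g x‖ₑ ^ 2 =
      ∫⁻ ξ, ‖(ε : ℂ) * (m ξ - 1) * (2 * Real.pi * Complex.I * (ξ j : ℂ)) * F ξ‖ₑ ^ 2 := by
    calc _ = ∫⁻ x, ‖(ε • (hgy.toLp _ - g) : Lp (α := Space d) ℂ 2 volume) x‖ₑ ^ 2 := by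
          refine lintegral_congr_ae ?_
          filter_upwards [hgy.coeFn_toLp, Lp.coeFn_sub (hgy.toLp _) g,
            Lp.coeFn_smul ε (hgy.toLp _ - g)] with x h1 h2 h3
          rw [h3, Pi.smul_apply, h2, Pi.sub_apply, h1, smul_sub]
      _ = ∫⁻ ξ, ‖(𝓕 (ε • (hgy.toLp _ - g) : Lp (α := Space d) ℂ 2 volume) :
            Lp (α := Space d) ℂ 2 volume) ξ‖ₑ ^ 2 := by
          rw [← eLpNorm_two_sq, ← eLpNorm_two_sq, ← Lp.enorm_def, ← Lp.enorm_def]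
          simp only [enorm_eq_nnnorm]
          congr 2
          exact (NNReal.eq (Lp.norm_fourier_eq _)).symm
      _ = _ := by
          have e4 : 𝓕 (ε • (hgy.toLp _ - g) : Lp (α := Space d) ℂ 2 volume) =
              ε • (hFy.toLp _ - 𝓕 g) := by
            have : (ε • (hgy.toLp _ - g) : Lp (α := Space d) ℂ 2 volume) =
              (ε : ℂ) • (hgy.toLp _ - g) := (Complex.coe_smul _ _).symm
            rw [this, FourierTransform.fourier_smul, sub_eq_add_neg, FourierTransform.fourier_add,
              FourierTransform.fourier_neg, e2, ← sub_eq_add_neg]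
            exact Complex.coe_smul _ _
          rw [e4]
          refine lintegral_congr_ae ?_
          have h4 : (𝓕 g : Lp (α := Space d) ℂ 2 volume) =ᵐ[volume] _ :=
            e1 ▸ hFg.coeFn_toLp
          filter_upwards [hFy.coeFn_toLp, Lp.coeFn_sub (hFy.toLp _) (𝓕 g),
            Lp.coeFn_smul ε (hFy.toLp _ - 𝓕 g), h4] with ξ h1 h2 h3 h4
          rw [h3, Pi.smul_apply, h2, Pi.sub_apply, h1, h4]
          congr 2
          rw [Complex.real_smul]
          ring
  rw [e3]
  refine (lintegral_mono fun ξ => hpt (4 * ‖y‖ ^ (2 * min κ 1)) _ ξ (by positivity) ?_).trans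
    ((lintegral_const_mul' _ _ ENNReal.ofReal_ne_top).le.trans (mul_le_mul' le_rfl hsum))
  have h1 := norm_exp_sub_one_sq_mul_le hκ (θ := -(2 * Real.pi * inner ℝ (ε • y) ξ))
    (norm_nonneg y) (ht0 ξ) (by
      rw [abs_neg]
      have : 2 * Real.pi * inner ℝ (ε • y) ξ = inner ℝ y ((2 * Real.pi * ε) • ξ) := by
        rw [inner_smul_left, inner_smul_right]; simp; ring
      rw [this]
      exact abs_real_inner_le_norm _ _)
  refine le_trans ?_ h1
  have h2 : ‖(ε : ℂ) * (m ξ - 1) * (2 * Real.pi * Complex.I * (ξ j : ℂ))‖ =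
      ‖m ξ - 1‖ * |2 * Real.pi * ε * ξ j| := by
    simp [abs_mul, abs_of_pos hε, abs_of_pos Real.pi_pos]
    ring
  rw [h2, mul_pow]
  gcongr
  exact hξ ξ

end

/-! ### Testing the Wigner function -/

/-- The tensor product of two Schwartz functions is a Schwartz function. -/
theorem exists_schwartz_tensor {E F : Type*} [NormedAddCommGroup E] [NormedSpace ℝ E]
    [NormedAddCommGroup F] [NormedSpace ℝ F] (f : 𝓢(E, ℂ)) (g : 𝓢(F, ℂ)) :
    ∃ T : 𝓢(E × F, ℂ), ∀ z, T z = f z.1 * g z.2 := by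
  have hf : ContDiff ℝ ∞ fun z : E × F => f z.1 := (f.smooth ⊤).comp contDiff_fst
  have hg : ContDiff ℝ ∞ fun z : E × F => g z.2 := (g.smooth ⊤).comp contDiff_snd
  have hfd : ∀ (i : ℕ) (z : E × F), ‖iteratedFDeriv ℝ i (fun z : E × F => f z.1) z‖ ≤
      ‖iteratedFDeriv ℝ i f z.1‖ := by
    intro i z
    have h := (ContinuousLinearMap.fst ℝ E F).iteratedFDeriv_comp_right (f.smooth ⊤) z
      (i := i) (mod_cast le_top)
    change ‖iteratedFDeriv ℝ i (f ∘ ContinuousLinearMap.fst ℝ E F) z‖ ≤ _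
    rw [h]
    refine (ContinuousMultilinearMap.norm_compContinuousLinearMap_le _ _).trans ?_
    refine mul_le_of_le_one_right (norm_nonneg _) ?_
    exact Finset.prod_le_one (fun _ _ => norm_nonneg _)
      fun _ _ => ContinuousLinearMap.norm_fst_le ..
  have hgd : ∀ (i : ℕ) (z : E × F), ‖iteratedFDeriv ℝ i (fun z : E × F => g z.2) z‖ ≤
      ‖iteratedFDeriv ℝ i g z.2‖ := by
    intro i z
    have h := (ContinuousLinearMap.snd ℝ E F).iteratedFDeriv_comp_right (g.smooth ⊤) z
      (i := i) (mod_cast le_top)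
    change ‖iteratedFDeriv ℝ i (g ∘ ContinuousLinearMap.snd ℝ E F) z‖ ≤ _
    rw [h]
    refine (ContinuousMultilinearMap.norm_compContinuousLinearMap_le _ _).trans ?_
    refine mul_le_of_le_one_right (norm_nonneg _) ?_
    exact Finset.prod_le_one (fun _ _ => norm_nonneg _)
      fun _ _ => ContinuousLinearMap.norm_snd_le ..
  choose Cf hCf0 hCf using f.decay
  choose Cg hCg0 hCg using g.decay
  refine ⟨⟨fun z => f z.1 * g z.2, hf.mul hg, fun k n => ⟨∑ i ∈ Finset.range (n + 1),
    (n.choose i : ℝ) * (Cf k i * Cg 0 (n - i) + Cf 0 i * Cg k (n - i)), fun z => ?_⟩⟩,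
    fun z => rfl⟩
  have hz : ‖z‖ ^ k ≤ ‖z.1‖ ^ k + ‖z.2‖ ^ k := by
    rcases le_total ‖z.1‖ ‖z.2‖ with h | h
    · rw [Prod.norm_def, max_eq_right h]
      exact le_add_of_nonneg_left (by positivity)
    · rw [Prod.norm_def, max_eq_left h]
      exact le_add_of_nonneg_right (by positivity)
  calc _ ≤ ‖z‖ ^ k * ∑ i ∈ Finset.range (n + 1), (n.choose i : ℝ) *
        ‖iteratedFDeriv ℝ i (fun z : E × F => f z.1) z‖ *
        ‖iteratedFDeriv ℝ (n - i) (fun z : E × F => g z.2) z‖ := by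
        gcongr
        exact norm_iteratedFDeriv_mul_le hf hg z (mod_cast le_top)
    _ ≤ _ := by
        rw [Finset.mul_sum]
        refine Finset.sum_le_sum fun i _ => ?_
        set a := ‖iteratedFDeriv ℝ i f z.1‖
        set b := ‖iteratedFDeriv ℝ (n - i) g z.2‖
        have h1 : ‖z.1‖ ^ k * a ≤ Cf k i := hCf k i z.1
        have h2 : a ≤ Cf 0 i := by simpa using hCf 0 i z.1
        have h3 : ‖z.2‖ ^ k * b ≤ Cg k (n - i) := hCg k (n - i) z.2
        have h4 : b ≤ Cg 0 (n - i) := by simpa using hCg 0 (n - i) z.2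
        have ha : 0 ≤ a := norm_nonneg _
        have hb : 0 ≤ b := norm_nonneg _
        calc _ ≤ (‖z.1‖ ^ k + ‖z.2‖ ^ k) * ((n.choose i : ℝ) * a * b) := by
              gcongr
              · exact hfd i z
              · exact hgd (n - i) z
          _ = (n.choose i : ℝ) * ((‖z.1‖ ^ k * a) * b + a * (‖z.2‖ ^ k * b)) := by ring
          _ ≤ _ := by
              gcongr
              · exact (hCf0 k i).le
              · exact (hCf0 0 i).le

section
variable {d : ℕ} {f : Space d → ℂ}

theorem integrable_correlation (hf : MemLp f 2 volume) {s : ℝ} (hs : s ≠ 0) (x : Space d) :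
    Integrable fun y => f (x - s • y) * conj (f (x + s • y)) := by
  have hm : ∀ s : ℝ, s ≠ 0 → MemLp (fun y => f (x + s • y)) 2 volume := by
    intro s hs
    have h1 := hf.comp_measurePreserving (measurePreserving_add_left volume x)
    refine (memLp_two_iff_lintegral (h1.aestronglyMeasurable.comp_quasiMeasurePreserving
      (Measure.quasiMeasurePreserving_smul volume hs))).2 ?_
    have h2 := ((h1.integrable_norm_pow two_ne_zero).comp_smul hs)
    have h3 := h2.lintegral_lt_top
    refine lt_of_eq_of_lt (lintegral_congr fun y => ?_) h3
    simp [ENNReal.ofReal_pow]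
  have h1 := hm (-s) (neg_ne_zero.2 hs)
  simp only [neg_smul, ← sub_eq_add_neg] at h1
  exact h1.integrable_mul (hm s hs).star

theorem integral_norm_correlation_le (hf : MemLp f 2 volume) {s : ℝ} (hs : s ≠ 0) (x : Space d) :
    ∫ y, ‖f (x - s • y) * conj (f (x + s • y))‖ ≤ ∫ y, ‖f (s • y)‖ ^ 2 := by
  have h0 : Integrable fun y => ‖f (s • y)‖ ^ 2 :=
    (hf.integrable_norm_pow two_ne_zero).comp_smul hs
  have e1 : ∀ y, x - s • y = s • (s⁻¹ • x - y) := fun y => by rw [smul_sub, smul_inv_smul₀ hs]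
  have e2 : ∀ y, x + s • y = s • (s⁻¹ • x + y) := fun y => by rw [smul_add, smul_inv_smul₀ hs]
  have h1 : Integrable fun y => ‖f (x - s • y)‖ ^ 2 := by
    simp_rw [e1]; exact h0.comp_sub_left (s⁻¹ • x)
  have h2 : Integrable fun y => ‖f (x + s • y)‖ ^ 2 := by
    simp_rw [e2]; exact h0.comp_add_left (s⁻¹ • x)
  have i1 : ∫ y, ‖f (x - s • y)‖ ^ 2 = ∫ y, ‖f (s • y)‖ ^ 2 := by
    simp_rw [e1]; exact integral_sub_left_eq_self (fun y => ‖f (s • y)‖ ^ 2) volume (s⁻¹ • x)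
  have i2 : ∫ y, ‖f (x + s • y)‖ ^ 2 = ∫ y, ‖f (s • y)‖ ^ 2 := by
    simp_rw [e2]; exact integral_add_left_eq_self (fun y => ‖f (s • y)‖ ^ 2) (s⁻¹ • x)
  calc _ ≤ ∫ y, (‖f (x - s • y)‖ ^ 2 + ‖f (x + s • y)‖ ^ 2) / 2 := by
        refine integral_mono (integrable_correlation hf hs x).norm ((h1.add h2).div_const 2)
          fun y => ?_
        simp only [norm_mul, RCLike.norm_conj]
        nlinarith [sq_nonneg (‖f (x - s • y)‖ - ‖f (x + s • y)‖)]
    _ = _ := by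
        rw [integral_div, integral_add h1 h2, i1, i2]; ring

/-- The symbol `p ↦ 𝓕 a (p / 2π)`, i.e. the Fourier transform `∫ a(y) e^{-i y·p} dy`. -/
noncomputable def angularSymbol (a : 𝓢(Space d, ℂ)) : 𝓢(Space d, ℂ) :=
  SchwartzMap.compCLMOfContinuousLinearEquiv ℂ
    (ContinuousLinearEquiv.smulLeft (Units.mk0 ((2 * Real.pi)⁻¹ : ℝ) (by positivity))) (𝓕 a)

theorem angularSymbol_apply (a : 𝓢(Space d, ℂ)) (p : Space d) :
    angularSymbol a p = 𝓕 a ((2 * Real.pi)⁻¹ • p) := rfl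

/-- Fourier inversion in the momentum variable of the Wigner function. -/
theorem integral_angularSymbol_mul_wignerFun (hf : MemLp f 2 volume) {ε : ℝ} (hε : 0 < ε)
    (a : 𝓢(Space d, ℂ)) (x : Space d) :
    ∫ p, angularSymbol a p * wignerFun ε f x p =
      ∫ y, a y * (f (x - (ε / 2) • y) * conj (f (x + (ε / 2) • y))) := by
  set W : Space d → ℂ := fun y => f (x - (ε / 2) • y) * conj (f (x + (ε / 2) • y)) with hWdef
  have hW : Integrable W := integrable_correlation hf (by positivity) x
  have hpi : (2 * Real.pi) ≠ 0 := by positivity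
  have hw : ∀ q : Space d, wignerFun ε f x ((2 * Real.pi) • q) =
      (((2 * Real.pi) ^ d)⁻¹ : ℝ) * 𝓕 W (-q) := by
    intro q
    rw [wignerFun, Real.fourier_eq']
    congr 1
    refine integral_congr_ae (Eventually.of_forall fun y => ?_)
    simp only [hWdef, smul_eq_mul, inner_smul_right, inner_neg_right]
    rw [mul_comm]
    congr 2
    push_cast
    ring
  have h1 : ∫ p, angularSymbol a p * wignerFun ε f x p =
      ∫ q, 𝓕 a q * 𝓕 W (-q) := by
    have := Measure.integral_comp_smul volume
      (fun p => angularSymbol a p * wignerFun ε f x p) (2 * Real.pi)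
    simp only [hw, angularSymbol_apply, inv_smul_smul₀ hpi] at this
    rw [finrank_euclideanSpace_fin, abs_of_nonneg (by positivity)] at this
    have h2 : ∀ q, 𝓕 a q * ((((2 * Real.pi) ^ d)⁻¹ : ℝ) * 𝓕 W (-q)) =
        ((((2 * Real.pi) ^ d)⁻¹ : ℝ) : ℂ) * (𝓕 a q * 𝓕 W (-q)) := fun q => by ring
    simp_rw [h2] at this
    rw [integral_const_mul, Complex.real_smul] at this
    exact (mul_left_cancel₀ (by
      rw [Complex.ofReal_ne_zero]; positivity) this).symm
  rw [h1, ← integral_neg_eq_self]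
  simp only [neg_neg]
  have hflip : ∫ ξ, 𝓕 W ξ • 𝓕 a (-ξ) = ∫ y, W y • 𝓕 (fun ξ => 𝓕 a (-ξ)) y := by
    simpa using! VectorFourier.integral_fourierIntegral_smul_eq_flip (L := innerₗ (Space d))
      Real.continuous_fourierChar continuous_inner hW (𝓕 a).integrable.comp_neg
  have hinv : ∀ y, 𝓕 (fun ξ => 𝓕 a (-ξ)) y = a y := by
    intro y
    rw [← Real.fourierInv_eq_fourier_comp_neg, ← SchwartzMap.fourierInv_coe,
      FourierTransform.fourierInv_fourier_eq]
  simp only [hinv, smul_eq_mul] at hflip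
  simp only [mul_comm (𝓕 a _), mul_comm (a _)]
  exact hflip

theorem stronglyMeasurable_wignerFun (hf : StronglyMeasurable f) (ε : ℝ) :
    StronglyMeasurable fun z : Space d × Space d => wignerFun ε f z.1 z.2 := by
  unfold wignerFun
  refine StronglyMeasurable.const_mul ?_ _
  refine StronglyMeasurable.integral_prod_right
    (f := fun (z : Space d × Space d) (y : Space d) => f (z.1 - (ε / 2) • y) *
      conj (f (z.1 + (ε / 2) • y)) * Complex.exp (Complex.I * ((inner ℝ y z.2 : ℝ) : ℂ))) ?_
  have h1 : StronglyMeasurable fun z : (Space d × Space d) × Space d =>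
      f (z.1.1 - (ε / 2) • z.2) := hf.comp_measurable (by fun_prop)
  have h2 : StronglyMeasurable fun z : (Space d × Space d) × Space d =>
      f (z.1.1 + (ε / 2) • z.2) := hf.comp_measurable (by fun_prop)
  have h3 : Continuous fun z : (Space d × Space d) × Space d =>
    Complex.exp (Complex.I * ((inner ℝ z.2 z.1.2 : ℝ) : ℂ)) := by fun_prop
  exact (h1.mul (Complex.continuous_conj.comp_stronglyMeasurable h2)).mul h3.stronglyMeasurable

theorem norm_wignerFun_le (hf : MemLp f 2 volume) {ε : ℝ} (hε : 0 < ε) (x p : Space d) :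
    ‖wignerFun ε f x p‖ ≤ ((2 * Real.pi) ^ d)⁻¹ * ∫ y, ‖f ((ε / 2) • y)‖ ^ 2 := by
  rw [wignerFun, norm_mul, Complex.norm_real, Real.norm_of_nonneg (by positivity)]
  gcongr
  refine (norm_integral_le_integral_norm _).trans
    (le_trans (le_of_eq ?_) (integral_norm_correlation_le hf (by positivity) x))
  refine integral_congr_ae (Eventually.of_forall fun y => ?_)
  simp only
  rw [norm_mul _ (Complex.exp _), Complex.norm_exp_I_mul_ofReal, mul_one]

theorem integral_tensor_mul_wignerFun (hfm : StronglyMeasurable f) (hf : MemLp f 2 volume)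
    {ε : ℝ} (hε : 0 < ε) (χ a : 𝓢(Space d, ℂ)) :
    ∫ z : Space d × Space d, (χ z.1 * angularSymbol a z.2) * wignerFun ε f z.1 z.2 =
      ∫ x, χ x * ∫ y, a y * (f (x - (ε / 2) • y) * conj (f (x + (ε / 2) • y))) := by
  have hint : Integrable (fun z : Space d × Space d =>
      (χ z.1 * angularSymbol a z.2) * wignerFun ε f z.1 z.2) (volume.prod volume) :=
    (χ.integrable.mul_prod (angularSymbol a).integrable).mul_bdd
      (stronglyMeasurable_wignerFun hfm ε).aestronglyMeasurable
      (Eventually.of_forall fun z => norm_wignerFun_le hf hε z.1 z.2)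
  rw [Measure.volume_eq_prod, integral_prod _ hint]
  refine integral_congr_ae (Eventually.of_forall fun x => ?_)
  simp only [mul_assoc]
  rw [integral_const_mul, integral_angularSymbol_mul_wignerFun hf hε]

/-! ### Localised energy of an average of translates -/

theorem memLp_translate (hf : MemLp f 2 volume) (v : Space d) :
    MemLp (fun x => f (x - v)) 2 volume :=
  hf.comp_measurePreserving (measurePreserving_sub_right volume v)

theorem integrable_norm_mul_translate (hf : MemLp f 2 volume) (u v : Space d) :
    Integrable fun x => ‖f (x - u)‖ * ‖f (x - v)‖ :=
  (memLp_translate hf u).norm.integrable_mul (memLp_translate hf v).norm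

theorem integral_norm_mul_translate_le (hf : MemLp f 2 volume) (u v : Space d) :
    ∫ x, ‖f (x - u)‖ * ‖f (x - v)‖ ≤ ∫ x, ‖f x‖ ^ 2 := by
  have hsq : ∀ v : Space d, Integrable fun x => ‖f (x - v)‖ ^ 2 := fun v =>
    (memLp_translate hf v).integrable_norm_pow two_ne_zero
  have hsqi : ∀ v : Space d, ∫ x, ‖f (x - v)‖ ^ 2 = ∫ x, ‖f x‖ ^ 2 := fun v =>
    integral_sub_right_eq_self (fun x => ‖f x‖ ^ 2) v
  calc _ ≤ ∫ x, (‖f (x - u)‖ ^ 2 + ‖f (x - v)‖ ^ 2) / 2 := by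
        refine integral_mono (integrable_norm_mul_translate hf u v)
          (((hsq _).add (hsq _)).div_const 2) fun x => ?_
        simp only
        nlinarith [sq_nonneg (‖f (x - u)‖ - ‖f (x - v)‖)]
    _ = _ := by
        rw [integral_div, integral_add (hsq _) (hsq _), hsqi, hsqi]; ring

theorem norm_integral_mul_correlation_le (hf : MemLp f 2 volume) {B : Space d → ℂ} {M : ℝ}
    (hM : ∀ x, ‖B x‖ ≤ M) (u v : Space d) :
    ‖∫ x, B x * (f (x - u) * conj (f (x - v)))‖ ≤ M * ∫ x, ‖f x‖ ^ 2 := by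
  have hM0 : 0 ≤ M := (norm_nonneg _).trans (hM 0)
  refine (norm_integral_le_of_norm_le ((integrable_norm_mul_translate hf u v).const_mul M)
    (Eventually.of_forall fun x => ?_)).trans ?_
  · rw [norm_mul, norm_mul, RCLike.norm_conj]
    exact mul_le_mul_of_nonneg_right (hM x) (by positivity)
  · rw [integral_const_mul]
    exact mul_le_mul_of_nonneg_left (integral_norm_mul_translate_le hf u v) hM0

/-- Joint integrability of `B(x, y) k(y) f(x - s(y)) conj f(x - t(y))` for `f ∈ L²`, `k ∈ L¹` and `B`
bounded. -/
theorem integrable_prod_correlation {Y : Type*} [MeasurableSpace Y] {μ : Measure Y} [SFinite μ]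
    (hfm : StronglyMeasurable f) (hf : MemLp f 2 volume) {B : Space d × Y → ℂ}
    (hB : StronglyMeasurable B) {M : ℝ} (hM : ∀ z, ‖B z‖ ≤ M) {k : Y → ℂ}
    (hk : Integrable k μ) {s t : Y → Space d} (hs : Measurable s) (ht : Measurable t) :
    Integrable (fun z : Space d × Y => B z * (k z.2 * (f (z.1 - s z.2) * conj (f (z.1 - t z.2)))))
      (volume.prod μ) := by
  have hF : StronglyMeasurable fun z : Space d × Y => f (z.1 - s z.2) * conj (f (z.1 - t z.2)) := by
    have h1 : StronglyMeasurable fun z : Space d × Y => f (z.1 - s z.2) :=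
      hfm.comp_measurable (by fun_prop)
    have h2 : StronglyMeasurable fun z : Space d × Y => f (z.1 - t z.2) :=
      hfm.comp_measurable (by fun_prop)
    exact h1.mul (Complex.continuous_conj.comp_stronglyMeasurable h2)
  refine Integrable.bdd_mul ?_ hB.aestronglyMeasurable (Eventually.of_forall hM)
  have hm : AEStronglyMeasurable
      (fun z : Space d × Y => k z.2 * (f (z.1 - s z.2) * conj (f (z.1 - t z.2))))
      (volume.prod μ) := hk.aestronglyMeasurable.comp_snd.mul hF.aestronglyMeasurable
  rw [integrable_prod_iff' hm]
  refine ⟨Eventually.of_forall fun y =>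
    Integrable.const_mul (f := fun x => f (x - s y) * conj (f (x - t y)))
      ((memLp_translate hf (s y)).integrable_mul (memLp_translate hf (t y)).star) (k y), ?_⟩
  refine Integrable.mono' (hk.norm.mul_const (∫ x, ‖f x‖ ^ 2))
    hm.norm.prod_swap.integral_prod_right' (Eventually.of_forall fun y => ?_)
  rw [Real.norm_of_nonneg (integral_nonneg fun _ => norm_nonneg _)]
  simp only [norm_mul, RCLike.norm_conj]
  rw [integral_const_mul]
  exact mul_le_mul_of_nonneg_left (integral_norm_mul_translate_le hf _ _) (norm_nonneg _)

end

section
variable {d : ℕ} {f : Space d → ℂ}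

/-- The Schwartz function `-(c ⋆ c)`. For odd `c`, the only case of interest, it is the
autocorrelation `z ↦ ∫ c(y) c(y + z) dy`. -/
noncomputable def oddAutocorrelation {c : Space d → ℝ} (hc : ContDiff ℝ ∞ c)
    (hcc : HasCompactSupport c) : 𝓢(Space d, ℂ) :=
  -(SchwartzMap.convolution (ContinuousLinearMap.mul ℂ ℂ) (testSchwartz hc hcc)
    (testSchwartz hc hcc))

theorem oddAutocorrelation_apply {c : Space d → ℝ} (hc : ContDiff ℝ ∞ c)
    (hcc : HasCompactSupport c) (hodd : ∀ y, c (-y) = -c y) (z : Space d) :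
    oddAutocorrelation hc hcc z = ∫ y, (c (z + y) : ℂ) * (c y : ℂ) := by
  rw [oddAutocorrelation, neg_apply, SchwartzMap.convolution_apply, convolution_def,
    ← integral_neg_eq_self, ← integral_neg]
  refine integral_congr_ae (Eventually.of_forall fun y => ?_)
  simp [testSchwartz_apply, hodd]
  ring

theorem angularSymbol_oddAutocorrelation {c : Space d → ℝ} (hc : ContDiff ℝ ∞ c)
    (hcc : HasCompactSupport c) (p : Space d) :
    angularSymbol (oddAutocorrelation hc hcc) p =
      -(𝓕 (testSchwartz hc hcc) ((2 * Real.pi)⁻¹ • p)) ^ 2 := by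
  rw [angularSymbol_apply, oddAutocorrelation, FourierTransform.fourier_neg, neg_apply,
    SchwartzMap.fourier_convolution]
  simp [SchwartzMap.pairing_apply_apply, sq]

/-- Up to an error of order `ε`, the localised energy `∫ χ |v|²` of the average of translates
`v(x) = ∫ c(y) f(x - ε y) dy` is the Wigner function of `f` tested against `χ(x) |ĉ(p)|²`. -/
theorem norm_localEnergy_sub_le (hfm : StronglyMeasurable f) (hf : MemLp f 2 volume)
    {ε : ℝ} (hε : 0 < ε) {c : Space d → ℝ} (hc : ContDiff ℝ ∞ c) (hcc : HasCompactSupport c)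
    (hodd : ∀ y, c (-y) = -c y) {h : ℝ} (hh : ∀ y, c y ≠ 0 → ‖y‖ ≤ h)
    {χ : Space d → ℝ} (hχ : ContDiff ℝ ∞ χ) (hχc : HasCompactSupport χ) {L : NNReal}
    (hL : LipschitzWith L χ) :
    ‖(∫ x, (χ x : ℂ) * ((∫ y, (c y : ℂ) * f (x - ε • y)) *
          conj (∫ y, (c y : ℂ) * f (x - ε • y)))) -
        ∫ z : Space d × Space d, (testSchwartz hχ hχc z.1 *
          angularSymbol (oddAutocorrelation hc hcc) z.2) * wignerFun ε f z.1 z.2‖ ≤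
      ε * (L * h * (∫ z : Space d × Space d, ‖(c z.1 : ℂ) * (c z.2 : ℂ)‖) * ∫ x, ‖f x‖ ^ 2) := by
  rw [integral_tensor_mul_wignerFun hfm hf hε]
  set a := oddAutocorrelation hc hcc with ha
  have hcint : Integrable fun y => (c y : ℂ) := (testSchwartz hc hcc).integrable
  let k : Space d × Space d → ℂ := fun z => (c z.1 : ℂ) * (c z.2 : ℂ)
  have hk : Integrable k (volume.prod volume) := hcint.mul_prod hcint
  obtain ⟨M, hM⟩ := hχ.continuous.bounded_above_of_compact_support hχc
  have hM' : ∀ x, ‖(χ x : ℂ)‖ ≤ M := fun x => by rw [Complex.norm_real]; exact hM x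
  have hχm : StronglyMeasurable fun x => (χ x : ℂ) :=
    (Complex.continuous_ofReal.comp hχ.continuous).stronglyMeasurable
  -- the correlation localised by `χ`
  let P : Space d → ℂ := fun z => ∫ x, (χ x : ℂ) * (f (x - (ε / 2) • z) * conj (f (x + (ε / 2) • z)))
  have hPm : StronglyMeasurable P := by
    refine StronglyMeasurable.integral_prod_right (f := fun (z x : Space d) =>
      (χ x : ℂ) * (f (x - (ε / 2) • z) * conj (f (x + (ε / 2) • z)))) ?_
    have h1 : StronglyMeasurable fun z : Space d × Space d => f (z.2 - (ε / 2) • z.1) :=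
      hfm.comp_measurable (by fun_prop)
    have h2 : StronglyMeasurable fun z : Space d × Space d => f (z.2 + (ε / 2) • z.1) :=
      hfm.comp_measurable (by fun_prop)
    exact (hχm.comp_measurable measurable_snd).mul
      (h1.mul (Complex.continuous_conj.comp_stronglyMeasurable h2))
  have hPb : ∀ z, ‖P z‖ ≤ M * ∫ x, ‖f x‖ ^ 2 := by
    intro z
    have := norm_integral_mul_correlation_le hf hM' ((ε / 2) • z) (-((ε / 2) • z))
    simpa only [sub_neg_eq_add] using this
  have hPkint : Integrable (fun y : Space d × Space d => k y * P (y.1 - y.2))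
      (volume.prod volume) :=
    hk.mul_bdd (hPm.comp_measurable (by fun_prop)).aestronglyMeasurable
      (Eventually.of_forall fun y => hPb _)
  -- expand the square and integrate in `x` first
  have hI1 := integrable_prod_correlation (μ := (volume : Measure (Space d)).prod volume) hfm hf
    (B := fun z : Space d × (Space d × Space d) => (χ z.1 : ℂ))
    (hχm.comp_measurable measurable_fst) (fun z => hM' z.1) hk
    (s := fun y => ε • y.1) (t := fun y => ε • y.2) (by fun_prop) (by fun_prop)
  have s1 : (∫ x, (χ x : ℂ) * ((∫ y, (c y : ℂ) * f (x - ε • y)) *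
      conj (∫ y, (c y : ℂ) * f (x - ε • y)))) =
      ∫ y : Space d × Space d, k y * ∫ x, (χ x : ℂ) * (f (x - ε • y.1) * conj (f (x - ε • y.2))) := by
    calc _ = ∫ x, ∫ y : Space d × Space d,
          (χ x : ℂ) * (k y * (f (x - ε • y.1) * conj (f (x - ε • y.2)))) := by
          refine integral_congr_ae (Eventually.of_forall fun x => ?_)
          simp only
          rw [← integral_conj, Measure.volume_eq_prod, ← integral_prod_mul, ← integral_const_mul]
          refine integral_congr_ae (Eventually.of_forall fun y => ?_)
          simp only [map_mul, Complex.conj_ofReal, k]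
          ring
      _ = _ := by
          rw [Measure.volume_eq_prod, integral_integral_swap hI1]
          refine integral_congr_ae (Eventually.of_forall fun y => ?_)
          simp only
          rw [← integral_const_mul]
          refine integral_congr_ae (Eventually.of_forall fun x => ?_)
          simp only
          ring
  -- symmetrise the two translations
  have s2 : ∀ y : Space d × Space d,
      ∫ x, (χ x : ℂ) * (f (x - ε • y.1) * conj (f (x - ε • y.2))) =
      ∫ x, (χ (x + (ε / 2) • (y.1 + y.2)) : ℂ) *
        (f (x - (ε / 2) • (y.1 - y.2)) * conj (f (x + (ε / 2) • (y.1 - y.2)))) := by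
    intro y
    rw [← integral_add_right_eq_self _ ((ε / 2) • (y.1 + y.2))]
    refine integral_congr_ae (Eventually.of_forall fun x => ?_)
    have e1 : x + (ε / 2) • (y.1 + y.2) - ε • y.1 = x - (ε / 2) • (y.1 - y.2) := by module
    have e2 : x + (ε / 2) • (y.1 + y.2) - ε • y.2 = x + (ε / 2) • (y.1 - y.2) := by module
    simp only [e1, e2]
  have s3 : ∫ x, (testSchwartz hχ hχc x) *
        ∫ y, a y * (f (x - (ε / 2) • y) * conj (f (x + (ε / 2) • y))) =
      ∫ y : Space d × Space d, k y * P (y.1 - y.2) := by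
    have hmp := measurePreserving_add_prod (volume : Measure (Space d)) (volume : Measure (Space d))
    have hI2 := integrable_prod_correlation hfm hf
      (B := fun z : Space d × Space d => (χ z.1 : ℂ))
      (hχm.comp_measurable measurable_fst) (fun z => hM' z.1)
      (a.integrable (μ := volume))
      (s := fun y => (ε / 2) • y) (t := fun y => -((ε / 2) • y)) (by fun_prop) (by fun_prop)
    simp only [sub_neg_eq_add] at hI2
    calc _ = ∫ x, ∫ y, (χ x : ℂ) * (a y * (f (x - (ε / 2) • y) * conj (f (x + (ε / 2) • y)))) := by
          refine integral_congr_ae (Eventually.of_forall fun x => ?_)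
          simp only [testSchwartz_apply]
          rw [integral_const_mul]
      _ = ∫ y, a y * P y := by
          rw [integral_integral_swap hI2]
          refine integral_congr_ae (Eventually.of_forall fun y => ?_)
          simp only [P]
          rw [← integral_const_mul]
          refine integral_congr_ae (Eventually.of_forall fun x => ?_)
          simp only
          ring
      _ = ∫ z, ∫ y, ((c (z + y) : ℂ) * (c y : ℂ)) * P z := by
          refine integral_congr_ae (Eventually.of_forall fun z => ?_)
          simp only
          rw [integral_mul_const, ha, oddAutocorrelation_apply hc hcc hodd]
      _ = _ := by
          have h2 := hPkint
          rw [← hmp.map_eq] at h2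
          have h3 := h2.comp_measurable hmp.measurable
          simp only [Function.comp_def, add_sub_cancel_right, k] at h3
          rw [Measure.volume_eq_prod]
          conv_rhs => rw [← hmp.map_eq]
          rw [integral_map hmp.aemeasurable (hmp.map_eq.symm ▸ hPkint.aestronglyMeasurable)]
          simp only [add_sub_cancel_right, k]
          rw [integral_prod _ h3]
  have hQint : Integrable (fun y : Space d × Space d =>
      k y * ∫ x, (χ (x + (ε / 2) • (y.1 + y.2)) : ℂ) *
        (f (x - (ε / 2) • (y.1 - y.2)) * conj (f (x + (ε / 2) • (y.1 - y.2)))))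
      (volume.prod volume) := by
    refine hI1.integral_prod_right.congr (Eventually.of_forall fun y => ?_)
    simp only
    rw [← s2 y, ← integral_const_mul]
    refine integral_congr_ae (Eventually.of_forall fun x => ?_)
    simp only
    ring
  rw [s1, s3]
  simp_rw [s2]
  rw [Measure.volume_eq_prod, ← integral_sub hQint hPkint]
  have hbd : ∀ y : Space d × Space d,
      ‖k y * (∫ x, (χ (x + (ε / 2) • (y.1 + y.2)) : ℂ) *
        (f (x - (ε / 2) • (y.1 - y.2)) * conj (f (x + (ε / 2) • (y.1 - y.2))))) -
        k y * P (y.1 - y.2)‖ ≤ ‖k y‖ * ((L * (ε * h)) * ∫ x, ‖f x‖ ^ 2) := by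
    intro y
    rw [← mul_sub, norm_mul]
    by_cases hk0 : k y = 0
    · simp [hk0]
    refine mul_le_mul_of_nonneg_left ?_ (norm_nonneg _)
    have h1 : ‖y.1‖ ≤ h := hh _ fun h0 => hk0 (by simp [k, h0])
    have h2 : ‖y.2‖ ≤ h := hh _ fun h0 => hk0 (by simp [k, h0])
    have hint : ∀ (B : Space d → ℂ), Continuous B → (∀ x, ‖B x‖ ≤ M) → ∀ u : Space d,
        Integrable fun x => B x * (f (x - u) * conj (f (x + u))) := by
      intro B hBc hBM u
      have := (memLp_translate hf (-u)).star
      simp only [sub_neg_eq_add] at this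
      exact Integrable.bdd_mul (f := B) ((memLp_translate hf u).integrable_mul this)
        hBc.aestronglyMeasurable (Eventually.of_forall hBM)
    simp only [P]
    rw [← integral_sub (hint (fun x => (χ (x + (ε / 2) • (y.1 + y.2)) : ℂ))
        (Complex.continuous_ofReal.comp (hχ.continuous.comp (by fun_prop))) (fun x => hM' _) _)
      (hint (fun x => (χ x : ℂ)) (Complex.continuous_ofReal.comp hχ.continuous) hM' _)]
    have hB : ∀ x : Space d, ‖((χ (x + (ε / 2) • (y.1 + y.2)) : ℂ) - (χ x : ℂ))‖ ≤ L * (ε * h) := by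
      intro x
      rw [← Complex.ofReal_sub, Complex.norm_real]
      have h3 := hL.dist_le_mul (x + (ε / 2) • (y.1 + y.2)) x
      rw [dist_eq_norm, dist_eq_norm, add_sub_cancel_left, norm_smul,
        Real.norm_of_nonneg (by positivity : 0 ≤ ε / 2)] at h3
      refine h3.trans (mul_le_mul_of_nonneg_left ?_ L.2)
      have := norm_add_le y.1 y.2
      nlinarith
    have := norm_integral_mul_correlation_le hf hB ((ε / 2) • (y.1 - y.2))
      (-((ε / 2) • (y.1 - y.2)))
    simpa only [sub_neg_eq_add, sub_mul] using this
  refine (norm_integral_le_of_norm_le (hk.norm.mul_const _) (Eventually.of_forall hbd)).trans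
    (le_of_eq ?_)
  rw [integral_mul_const]
  ring

end

/-! ### No loss of kinetic energy in the Wigner limit -/

section
variable {d : ℕ}

/-- The Fourier symbol of `∂ⱼη`, with `η` a mollifier, is at most `|pⱼ|`. -/
theorem norm_angularSymbol_bump_le (b : ContDiffBump (0 : Space d)) (j : Fin d)
    (hc : ContDiff ℝ ∞ fun y => fderiv ℝ (b.normed volume) y (EuclideanSpace.single j 1))
    (hcc : HasCompactSupport fun y => fderiv ℝ (b.normed volume) y (EuclideanSpace.single j 1))
    (p : Space d) : ‖angularSymbol (oddAutocorrelation hc hcc) p‖ ≤ ‖p j‖ ^ 2 := by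
  have hb : ContDiff ℝ ∞ (b.normed volume) := b.contDiff_normed
  have hbc : HasCompactSupport (b.normed volume) := b.hasCompactSupport_normed
  have h1 : testSchwartz hc hcc =
      LineDeriv.lineDerivOp (EuclideanSpace.single j (1 : ℝ)) (testSchwartz hb hbc) := by
    ext x
    rw [SchwartzMap.lineDerivOp_apply_eq_fderiv]
    have h1 : HasFDerivAt (fun x => ((b.normed volume) x : ℂ))
        (Complex.ofRealCLM.comp (fderiv ℝ (b.normed volume) x)) x :=
      Complex.ofRealCLM.hasFDerivAt.comp x ((hb.differentiable (by simp)) x).hasFDerivAt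
    have h2 : fderiv ℝ (testSchwartz hb hbc) x = _ := h1.fderiv
    rw [h2]
    simp [testSchwartz_apply]
  have h2 : ∀ q, ‖𝓕 (testSchwartz hb hbc) q‖ ≤ 1 := by
    intro q
    rw [SchwartzMap.fourier_coe, Real.fourier_eq']
    refine (norm_integral_le_integral_norm _).trans (le_of_eq ?_)
    rw [← b.integral_normed (μ := volume)]
    refine integral_congr_ae (Eventually.of_forall fun x => ?_)
    simp only [testSchwartz_apply]
    rw [norm_smul, Complex.norm_exp_ofReal_mul_I, one_mul, Complex.norm_real,
      Real.norm_of_nonneg (b.nonneg_normed x)]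
  have h3 : (fun y : Space d => (inner ℝ y (EuclideanSpace.single j (1 : ℝ)) : ℝ)).HasTemperateGrowth :=
    by fun_prop
  rw [angularSymbol_oddAutocorrelation, norm_neg, norm_pow, h1, SchwartzMap.fourier_lineDerivOp_eq,
    smul_apply, SchwartzMap.smulLeftCLM_apply_apply h3]
  gcongr
  rw [norm_smul, norm_smul]
  have h4 : ‖(2 * Real.pi * Complex.I : ℂ)‖ *
      ‖(inner ℝ ((2 * Real.pi)⁻¹ • p) (EuclideanSpace.single j (1 : ℝ)) : ℝ)‖ = ‖p j‖ := by
    rw [inner_smul_left, EuclideanSpace.inner_single_right]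
    simp [abs_of_pos Real.pi_pos]
    field_simp
  rw [← mul_assoc, h4]
  exact mul_le_of_le_one_right (norm_nonneg _) (h2 _)

/-- The kinetic energy in direction `j` does not concentrate outside of the second moment of the
Wigner measure: nothing is lost at infinite momentum, by the oscillation bound, nor at infinite
position, by compactness at infinity. -/
theorem eventually_lintegral_deriv_sq_le {j : Fin d} (ψ g : ℝ → Lp (α := Space d) ℂ 2 volume)
    (hg : ∀ ε ∈ Ioc (0 : ℝ) 1, HasWeakPartial j (ψ ε) (g ε))
    {C₀ C₁ : ℝ≥0∞} (hC₀ : C₀ ≠ ⊤) (hC₁ : C₁ ≠ ⊤)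
    (hψ : ∀ ε ∈ Ioc (0 : ℝ) 1, eLpNorm (ψ ε) 2 volume ≤ C₀)
    {κ : ℝ} (hκ : 0 < κ)
    (hosc : ∀ ε ∈ Ioc (0 : ℝ) 1,
      eLpNorm (fun ξ : Space d => ‖ε • ξ‖ ^ (κ + 1) • angularFourier (ψ ε) ξ) 2 volume ≤ C₁)
    (hcpt : CompactAtInfinity fun ε x => ε • g ε x)
    {l : Filter ℝ} (hl : l ≤ 𝓝[>] 0) {w : Measure (Space d × Space d)}
    (hw : TendstoTempered (fun ε => wignerFun ε (ψ ε)) l w)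
    (hint : Integrable (fun z : Space d × Space d => ‖z.2 j‖ ^ 2) w) {δ : ℝ} (hδ : 0 < δ) :
    ∀ᶠ ε in l, ∫⁻ x, ‖ε • g ε x‖ₑ ^ 2 ≤ ENNReal.ofReal ((∫ z, ‖z.2 j‖ ^ 2 ∂w) + δ) := by
  set W := ∫ z, ‖z.2 j‖ ^ 2 ∂w with hW
  have hW0 : 0 ≤ W := integral_nonneg fun _ => by positivity
  -- a tolerance `r` for all errors
  obtain ⟨r, hr, hrδ⟩ : ∃ r : ℝ, 0 < r ∧ (√(W + r) + √r) ^ 2 ≤ W + δ := by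
    have hcont : Continuous fun r : ℝ => (√(W + r) + √r) ^ 2 := by fun_prop
    have h0 := hcont.tendsto 0
    simp only [add_zero, Real.sqrt_zero, Real.sq_sqrt hW0] at h0
    have h1 := (h0.eventually_lt_const (by linarith : W < W + δ))
    obtain ⟨r, hr1, hr2⟩ := ((h1.filter_mono nhdsWithin_le_nhds).and
      (self_mem_nhdsWithin : Ioi (0 : ℝ) ∈ 𝓝[>] 0)).exists
    exact ⟨r, hr2, hr1.le⟩
  -- the radius `h` of the mollifier
  set s := 2 * min κ 1 with hs
  have hs0 : 0 < s := by have := lt_min hκ one_pos; positivity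
  obtain ⟨h, hh0, hh1, hhr⟩ : ∃ h : ℝ, 0 < h ∧ h ≤ 1 ∧
      ENNReal.ofReal (4 * h ^ s) * (C₀ ^ 2 + C₁ ^ 2) ≤ ENNReal.ofReal r := by
    have hcont : Continuous fun h : ℝ => 4 * h ^ s :=
      (Real.continuous_rpow_const hs0.le).const_mul 4
    have h0 := hcont.tendsto 0
    simp only [Real.zero_rpow hs0.ne', mul_zero] at h0
    have h1 := ENNReal.Tendsto.mul_const (b := C₀ ^ 2 + C₁ ^ 2) (ENNReal.tendsto_ofReal h0)
      (Or.inr (by simp [hC₀, hC₁]))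
    rw [ENNReal.ofReal_zero, zero_mul] at h1
    have h2 := (ENNReal.tendsto_nhds_zero.1 h1) (ENNReal.ofReal r) (by simpa using hr)
    obtain ⟨h, ⟨ha, hb⟩, hc⟩ := ((h2.filter_mono nhdsWithin_le_nhds).and
      (Ioo_mem_nhdsGT (one_pos : (0 : ℝ) < 1))).and self_mem_nhdsWithin |>.exists
    exact ⟨h, hc, hb.2.le, ha⟩
  let b : ContDiffBump (0 : Space d) := ⟨h / 2, h, by positivity, by linarith⟩
  set η := b.normed volume with hη
  have hηs : ContDiff ℝ ∞ η := b.contDiff_normed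
  have hηc : HasCompactSupport η := b.hasCompactSupport_normed
  let c : Space d → ℝ := fun y => fderiv ℝ η y (EuclideanSpace.single j 1)
  have hc : ContDiff ℝ ∞ c := (hηs.fderiv_right (m := ∞) (by simp)).clm_apply contDiff_const
  have hcc : HasCompactSupport c := hηc.fderiv_apply ℝ _
  have hodd : ∀ y, c (-y) = -c y := by
    intro y
    have h1 : (fun y => η (-y)) = η := funext fun y => b.normed_neg y
    have h2 := ((hηs.differentiable (by simp)) (-y)).hasFDerivAt.comp y (hasFDerivAt_id y).neg
    have h3 : fderiv ℝ η y = _ := (h2.congr_of_eventuallyEq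
      (Eventually.of_forall fun z => (congrFun h1 z).symm)).fderiv
    simp [c, h3]
  have hch : ∀ y, c y ≠ 0 → ‖y‖ ≤ h := by
    intro y hy
    have h1 : y ∈ tsupport η := by
      by_contra h0
      have : fderiv ℝ η y = 0 := image_eq_zero_of_notMem_tsupport
        fun h3 => h0 (tsupport_fderiv_subset ℝ h3)
      exact hy (by simp [c, this])
    rw [hη, b.tsupport_normed_eq] at h1
    simpa using h1
  -- the radius `R` of the cutoff in position
  obtain ⟨R, hR0, hR⟩ : ∃ R : ℝ, 0 ≤ R ∧ ∀ᶠ ε in 𝓝[>] (0 : ℝ),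
      ∫⁻ x in {x | R ≤ ‖x‖}, ‖ε • g ε x‖ₑ ^ 2 < ENNReal.ofReal (r / 3) := by
    have h1 := hcpt.eventually_lt_const (u := ENNReal.ofReal (r / 3)) (by simpa using hr)
    obtain ⟨R, h2, h3⟩ := (h1.and (eventually_ge_atTop 0)).exists
    exact ⟨R, h3, eventually_lt_of_limsup_lt h2⟩
  let χ : ContDiffBump (0 : Space d) := ⟨R + 1, R + 2, by positivity, by linarith⟩
  have hχ : ContDiff ℝ ∞ χ := χ.contDiff
  have hχc : HasCompactSupport χ := χ.hasCompactSupport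
  obtain ⟨L, hL⟩ := hχ.lipschitzWith_of_hasCompactSupport hχc (by simp)
  obtain ⟨T, hT⟩ := exists_schwartz_tensor (testSchwartz hχ hχc)
    (angularSymbol (oddAutocorrelation hc hcc))
  -- the test function `χ(x) |ĉ(p)|²` for the Wigner function, which is dominated by `|pⱼ|²`
  have hTlim := (hw T).norm
  have hTle : ‖∫ z, T z ∂w‖ ≤ W := by
    refine norm_integral_le_of_norm_le hint (Eventually.of_forall fun z => ?_)
    rw [hT, norm_mul]
    have h1 : ‖testSchwartz hχ hχc z.1‖ ≤ 1 := by
      rw [testSchwartz_apply, Complex.norm_real, Real.norm_of_nonneg χ.nonneg]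
      exact χ.le_one
    exact (mul_le_of_le_one_left (norm_nonneg _) h1).trans (norm_angularSymbol_bump_le b j hc hcc z.2)
  have hTev := hTlim.eventually_lt_const (by linarith : ‖∫ z, T z ∂w‖ < W + r / 3)
  -- the error in the localised energy
  set K : ℝ := L * h * (∫ z : Space d × Space d, ‖(c z.1 : ℂ) * (c z.2 : ℂ)‖) * (C₀ ^ 2).toReal
    with hK
  have hK0 : 0 ≤ K := by positivity
  have hKev : ∀ᶠ ε in 𝓝[>] (0 : ℝ), ε * K < r / 3 := by
    have : Tendsto (fun ε : ℝ => ε * K) (𝓝[>] 0) (𝓝 (0 * K)) :=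
      (tendsto_id.mono_left nhdsWithin_le_nhds).mul_const K
    rw [zero_mul] at this
    exact this.eventually_lt_const (by linarith)
  filter_upwards [hTev, hl hKev, hl hR, hl (Ioc_mem_nhdsGT one_pos)] with ε hε1 hε2 hε3 hε4
  have hε0 : 0 < ε := hε4.1
  have hψm := Lp.stronglyMeasurable (ψ ε)
  have hψ2 := Lp.memLp (ψ ε)
  let G : Space d → ℂ := fun x => ε • g ε x
  have hGm : StronglyMeasurable G := (Lp.stronglyMeasurable (g ε)).const_smul ε
  have hG2 : MemLp G 2 volume := (Lp.memLp (g ε)).const_smul ε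
  let v : Space d → ℂ := mollify b ε G
  have hvm : StronglyMeasurable v := StronglyMeasurable.mollify b hGm ε
  have hv2 : MemLp v 2 volume := MemLp.mollify b hGm hG2 ε
  have hv : ∀ x, v x = ∫ y, (c y : ℂ) * ψ ε (x - ε • y) := by
    intro x
    have h1 := (hg ε hε4).mollify_eq b hε0.ne' x
    simp only [Complex.real_smul] at h1
    change _ = ∫ y, (fderiv ℝ η y (EuclideanSpace.single j 1) : ℂ) * ψ ε (x - ε • y)
    rw [← h1, ← Complex.real_smul]
    simp only [v, G, mollify]
    exact integral_smul _ _
  -- the mollification error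
  have hmoll : eLpNorm (fun x => v x - G x) 2 volume ≤ ENNReal.ofReal √r := by
    have h1 : ∫⁻ x, ‖v x - G x‖ₑ ^ 2 ≤ ENNReal.ofReal r := by
      refine lintegral_mollify_sub_sq_le b hGm (fun x => integrable_bumpMeasure b
        (hG2.locallyIntegrable (by norm_num)) hε0.ne' x) fun y hy => ?_
      refine ((hg ε hε4).lintegral_translate_sub_le hε0 hκ
        ((hosc ε hε4).trans_lt hC₁.lt_top) y).trans (le_trans ?_ hhr)
      gcongr
      · exact hψ ε hε4
      · exact hosc ε hε4
    rw [← eLpNorm_two_sq] at h1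
    refine (ENNReal.pow_le_pow_left_iff two_ne_zero).1 (h1.trans (le_of_eq ?_))
    rw [← ENNReal.ofReal_pow (Real.sqrt_nonneg _), Real.sq_sqrt hr.le]
  -- the mass of the mollified function
  have hsq : ∫⁻ x, ‖v x‖ₑ ^ 2 ≤ ENNReal.ofReal (W + r) := by
    have hloc : ∫ x, χ x * ‖v x‖ ^ 2 ≤ W + r / 3 + r / 3 := by
      have h1 := norm_localEnergy_sub_le hψm hψ2 hε0 hc hcc hodd hch hχ hχc hL
      have h2 : ∫ x, ‖ψ ε x‖ ^ 2 ≤ (C₀ ^ 2).toReal := by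
        have h3 := pow_le_pow_left₀ (zero_le) (hψ ε hε4) 2
        rw [eLpNorm_two_sq] at h3
        rw [integral_eq_lintegral_of_nonneg_ae (Eventually.of_forall fun _ => by positivity)
          (hψm.norm.measurable.pow_const 2).aestronglyMeasurable]
        refine ENNReal.toReal_mono (by simp [hC₀]) (le_trans (le_of_eq ?_) h3)
        refine lintegral_congr fun x => ?_
        rw [ENNReal.ofReal_pow (norm_nonneg _), ofReal_norm]
      have h3 : (∫ x, (χ x : ℂ) * ((∫ y, (c y : ℂ) * ψ ε (x - ε • y)) *
          conj (∫ y, (c y : ℂ) * ψ ε (x - ε • y)))) = ((∫ x, χ x * ‖v x‖ ^ 2 : ℝ) : ℂ) := by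
        rw [← integral_complex_ofReal]
        refine integral_congr_ae (Eventually.of_forall fun x => ?_)
        simp only [← hv, Complex.mul_conj, Complex.normSq_eq_norm_sq]
        push_cast
        ring
      simp only [h3, ← hT] at h1
      have h4 : ε * (L * h * (∫ z : Space d × Space d, ‖(c z.1 : ℂ) * (c z.2 : ℂ)‖) *
          ∫ x, ‖ψ ε x‖ ^ 2) ≤ ε * K := by
        exact mul_le_mul_of_nonneg_left (mul_le_mul_of_nonneg_left h2 (by positivity)) hε0.le
      have h5 : ∫ x, χ x * ‖v x‖ ^ 2 ≤ ‖((∫ x, χ x * ‖v x‖ ^ 2 : ℝ) : ℂ)‖ := by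
        rw [Complex.norm_real]; exact le_abs_self _
      have h6 := norm_le_norm_add_norm_sub' ((∫ x, χ x * ‖v x‖ ^ 2 : ℝ) : ℂ)
        (∫ z : Space d × Space d, T z * wignerFun ε (ψ ε) z.1 z.2)
      linarith
    have hout : ∫⁻ x in {x | R + 1 ≤ ‖x‖}, ‖v x‖ₑ ^ 2 ≤ ENNReal.ofReal (r / 3) :=
      (lintegral_mollify_sq_outside_le b hGm hε0.le
        (mul_le_one₀ hε4.2 hh0.le hh1) R).trans hε3.le
    have hin : ∫⁻ x, ENNReal.ofReal (χ x * ‖v x‖ ^ 2) ≤ ENNReal.ofReal (W + r / 3 + r / 3) := by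
      rw [← ofReal_integral_eq_lintegral_ofReal]
      · exact ENNReal.ofReal_le_ofReal hloc
      · exact (hv2.integrable_norm_pow two_ne_zero).bdd_mul hχ.continuous.aestronglyMeasurable
          (c := 1) (Eventually.of_forall fun x => by
            rw [Real.norm_of_nonneg χ.nonneg]; exact χ.le_one)
      · exact Eventually.of_forall fun x => mul_nonneg χ.nonneg (by positivity)
    have hS : MeasurableSet {x : Space d | R + 1 ≤ ‖x‖} :=
      measurableSet_le measurable_const measurable_norm
    calc ∫⁻ x, ‖v x‖ₑ ^ 2
        ≤ ∫⁻ x, (ENNReal.ofReal (χ x * ‖v x‖ ^ 2) +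
            {x : Space d | R + 1 ≤ ‖x‖}.indicator (fun x => ‖v x‖ₑ ^ 2) x) := by
          refine lintegral_mono fun x => ?_
          by_cases hx : R + 1 ≤ ‖x‖
          · rw [indicator_of_mem (by exact hx)]
            exact le_add_of_nonneg_left zero_le
          · have : χ x = 1 := χ.one_of_mem_closedBall (by simpa using (not_le.1 hx).le)
            rw [this, one_mul, ENNReal.ofReal_pow (norm_nonneg _), ofReal_norm]
            exact le_add_of_nonneg_right zero_le
      _ = (∫⁻ x, ENNReal.ofReal (χ x * ‖v x‖ ^ 2)) + ∫⁻ x in {x | R + 1 ≤ ‖x‖}, ‖v x‖ₑ ^ 2 := by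
          rw [lintegral_add_right _ ((hvm.measurable.enorm.pow_const 2).indicator hS),
            lintegral_indicator hS]
      _ ≤ ENNReal.ofReal (W + r / 3 + r / 3) + ENNReal.ofReal (r / 3) := add_le_add hin hout
      _ = ENNReal.ofReal (W + r) := by
          rw [← ENNReal.ofReal_add (by positivity) (by positivity)]
          congr 1; ring
  have hv' : eLpNorm v 2 volume ≤ ENNReal.ofReal √(W + r) := by
    rw [← eLpNorm_two_sq] at hsq
    refine (ENNReal.pow_le_pow_left_iff two_ne_zero).1 (hsq.trans (le_of_eq ?_))
    rw [← ENNReal.ofReal_pow (Real.sqrt_nonneg _), Real.sq_sqrt (by positivity)]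
  have hfin : eLpNorm G 2 volume ≤ ENNReal.ofReal (√(W + r) + √r) := by
    have e : G = fun x => v x - (v x - G x) := by ext x; ring
    rw [ENNReal.ofReal_add (by positivity) (by positivity)]
    calc eLpNorm G 2 volume = eLpNorm (v - fun x => v x - G x) 2 volume := by
          conv_lhs => rw [e]
          rfl
      _ ≤ _ := (eLpNorm_sub_le hvm.aestronglyMeasurable
          (hvm.sub hGm).aestronglyMeasurable (by norm_num)).trans (add_le_add hv' hmoll)
  calc ∫⁻ x, ‖ε • g ε x‖ₑ ^ 2 = eLpNorm G 2 volume ^ 2 := (eLpNorm_two_sq _ _).symm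
    _ ≤ ENNReal.ofReal (√(W + r) + √r) ^ 2 := by gcongr
    _ ≤ _ := by
        rw [← ENNReal.ofReal_pow (by positivity)]
        exact ENNReal.ofReal_le_ofReal hrδ

end

/-! ### Second moments and the splitting of the kinetic energy -/

section
variable {d : ℕ}

theorem enorm_sq_eq_sum {𝕜 : Type*} [RCLike 𝕜] (x : EuclideanSpace 𝕜 (Fin d)) :
    ‖x‖ₑ ^ 2 = ∑ j, ‖x j‖ₑ ^ 2 := by
  simp only [← ofReal_norm]
  simp_rw [← ENNReal.ofReal_pow (norm_nonneg _)]
  rw [← ENNReal.ofReal_sum_of_nonneg fun _ _ => by positivity, EuclideanSpace.norm_sq_eq]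

/-- The second moment in `p` is lower semicontinuous under weak-* convergence. -/
theorem TendstoWeakStar.eventually_lt_lintegral {μ : ℝ → Measure (Space d × Space d)}
    {l : Filter ℝ} {ν : Measure (Space d × Space d)} [IsFiniteMeasure ν]
    (h : TendstoWeakStar μ l ν) {a : ℝ≥0∞} (ha : a < ∫⁻ z, ‖z.2‖ₑ ^ 2 ∂ν) :
    ∀ᶠ ε in l, a < ∫⁻ z, ‖z.2‖ₑ ^ 2 ∂(μ ε) := by
  let θ : ℕ → Space d × Space d → ℝ := fun n z => max 0 (min 1 (n - ‖z‖))
  have hθ0 : ∀ n z, 0 ≤ θ n z := fun n z => le_max_left _ _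
  have hθ1 : ∀ n z, θ n z ≤ 1 := fun n z => max_le zero_le_one (min_le_left _ _)
  let φ : ℕ → Space d × Space d → ℝ := fun n z => θ n z * ‖z.2‖ ^ 2
  have hφ0 : ∀ n z, 0 ≤ φ n z := fun n z => mul_nonneg (hθ0 n z) (by positivity)
  have hφcont : ∀ n, Continuous (φ n) := fun n => by fun_prop
  have hφc : ∀ n, HasCompactSupport (φ n) := by
    intro n
    refine HasCompactSupport.intro (isCompact_closedBall (0 : Space d × Space d) n) fun z hz => ?_
    have hz' : (n : ℝ) < ‖z‖ := by simpa using hz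
    have : θ n z = 0 := max_eq_left ((min_le_right _ _).trans (by linarith))
    simp only [φ, this, zero_mul]
  have hle : ∀ n z, ENNReal.ofReal (φ n z) ≤ ‖z.2‖ₑ ^ 2 := by
    intro n z
    rw [← ofReal_norm, ← ENNReal.ofReal_pow (norm_nonneg _)]
    exact ENNReal.ofReal_le_ofReal (mul_le_of_le_one_left (by positivity) (hθ1 n z))
  have hmono : Monotone fun n z => ENNReal.ofReal (φ n z) := by
    intro m n hmn z
    refine ENNReal.ofReal_le_ofReal (mul_le_mul_of_nonneg_right ?_ (by positivity))
    have : (m : ℝ) ≤ n := by exact_mod_cast hmn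
    exact max_le_max le_rfl (min_le_min le_rfl (by linarith))
  have hsup : ∀ z : Space d × Space d, ‖z.2‖ₑ ^ 2 = ⨆ n, ENNReal.ofReal (φ n z) := by
    intro z
    refine le_antisymm ?_ (iSup_le fun n => hle n z)
    obtain ⟨n, hn⟩ := exists_nat_ge (‖z‖ + 1)
    refine le_iSup_of_le n ?_
    have : θ n z = 1 := by
      simp only [θ]
      rw [min_eq_left (by linarith), max_eq_right zero_le_one]
    simp only [φ, this, one_mul]
    rw [← ofReal_norm, ENNReal.ofReal_pow (norm_nonneg _)]
  simp_rw [hsup] at ha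
  rw [lintegral_iSup (fun n => (hφcont n).measurable.ennreal_ofReal) hmono] at ha
  obtain ⟨n, hn⟩ := lt_iSup_iff.1 ha
  rw [← ofReal_integral_eq_lintegral_ofReal ((hφcont n).integrable_of_hasCompactSupport (hφc n))
    (Eventually.of_forall (hφ0 n))] at hn
  have hlim := ENNReal.tendsto_ofReal
    (h ⟨⟨φ n, hφcont n⟩, (hφc n).is_zero_at_infty⟩)
  filter_upwards [hlim.eventually_const_lt hn] with ε hε
  refine hε.trans_le (le_trans ?_ (lintegral_mono (hle n)))
  change ENNReal.ofReal (∫ z, φ n z ∂(μ ε)) ≤ _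
  by_cases hi : Integrable (φ n) (μ ε)
  · rw [ofReal_integral_eq_lintegral_ofReal hi (Eventually.of_forall (hφ0 n))]
  · rw [integral_undef hi]
    simp

/-- Pointwise splitting of the kinetic energy `|ε∇ψ|²` into the parts of `∇ψ` parallel and
orthogonal to `ψ` in `ℂ = ℝ²`: the former is `|ε∇|ψ||²`, the latter is `|J|² / ρ`. Equality can only
fail where `ψ = 0`, where both terms on the left are `0`. -/
theorem modulus_add_current_le (ε : ℝ) (z : ℂ) (G : EuclideanSpace ℂ (Fin d)) :
    ‖ε • (WithLp.toLp 2 fun j => (inner ℝ (‖z‖⁻¹ • z) (G j) : ℝ) : Space d)‖ₑ ^ 2 +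
      ENNReal.ofReal (‖z‖ ^ 2) * ‖(‖z‖ ^ 2)⁻¹ •
        (WithLp.toLp 2 fun j => ε * (conj z * G j).im : Space d)‖ₑ ^ 2 ≤
      ∑ j, ‖ε • G j‖ₑ ^ 2 := by
  simp only [← ofReal_norm]
  simp_rw [← ENNReal.ofReal_pow (norm_nonneg _)]
  rw [← ENNReal.ofReal_sum_of_nonneg fun _ _ => by positivity,
    ← ENNReal.ofReal_mul (by positivity), ← ENNReal.ofReal_add (by positivity) (by positivity)]
  refine ENNReal.ofReal_le_ofReal ?_
  rw [EuclideanSpace.norm_sq_eq, EuclideanSpace.norm_sq_eq, Finset.mul_sum, ← Finset.sum_add_distrib]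
  refine Finset.sum_le_sum fun j _ => ?_
  by_cases hz : z = 0
  · simp [hz]; positivity
  have hz0 : ‖z‖ ≠ 0 := norm_ne_zero_iff.2 hz
  have hin : (inner ℝ (‖z‖⁻¹ • z) (G j) : ℝ) = ‖z‖⁻¹ * (conj z * G j).re := by
    rw [inner_smul_left, Complex.inner, mul_comm (conj z)]; simp
  have hsq : (conj z * G j).re ^ 2 + (conj z * G j).im ^ 2 = ‖z‖ ^ 2 * ‖G j‖ ^ 2 := by
    rw [← mul_pow, ← RCLike.norm_conj z, ← norm_mul, Complex.sq_norm, Complex.normSq_apply]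
    ring
  refine le_of_eq ?_
  simp only [PiLp.smul_apply, norm_smul, hin, smul_eq_mul, norm_mul, norm_inv, norm_pow,
    mul_pow, Real.norm_eq_abs, sq_abs, inv_pow]
  have h1 : ‖G j‖ ^ 2 = (‖z‖ ^ 2)⁻¹ * ((conj z * G j).re ^ 2 + (conj z * G j).im ^ 2) := by
    rw [hsq]; field_simp
  rw [h1]
  field_simp

/-- The second moment of the Bohmian measure is the energy of the current. The inequality, which is
all that is used, needs no measurability of `G`. -/
theorem lintegral_bohmMeasure_le {ε : ℝ} {ψ : Space d → ℂ} (hψ : StronglyMeasurable ψ)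
    (G : Space d → EuclideanSpace ℂ (Fin d)) :
    ∫⁻ z, ‖z.2‖ₑ ^ 2 ∂(bohmMeasure ε ψ G) ≤
      ∫⁻ x, ENNReal.ofReal (‖ψ x‖ ^ 2) * ‖(‖ψ x‖ ^ 2)⁻¹ • currentDensity ε ψ G x‖ₑ ^ 2 := by
  refine (lintegral_map_le _ _).trans (lintegral_withDensity_le_lintegral_mul _ ?_ _)
  exact (hψ.norm.measurable.pow_const 2).ennreal_ofReal

end

/-! ### Convergence of the osmotic momentum -/

/-- The filter `l` encodes `ε → 0+`: it is `𝓝[>] 0` for the full family, and the image of `atTop`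
under `n ↦ εₙ` for an extracted subsequence. `Dψ ε` is the weak gradient of `ψ ε`, and `β`, `w` are
the limiting Bohmian measure and the Wigner measure. -/
theorem corollary4p7 {d : ℕ}
    (ψ : ℝ → Lp (α := Space d) ℂ 2 volume) (Dψ : ℝ → Space d → EuclideanSpace ℂ (Fin d))
    (hD : ∀ ε ∈ Ioc (0 : ℝ) 1, HasWeakGrad (ψ ε) (Dψ ε))
    (hH1 : (⨆ ε ∈ Ioc (0 : ℝ) 1, H1epsNorm ε (ψ ε) (Dψ ε)) < ⊤)
    (hcpt : CompactAtInfinity fun ε x => ε • Dψ ε x)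
    (κ : ℝ) (hκ : 0 < κ)
    (hosc : (⨆ ε ∈ Ioc (0 : ℝ) 1,
      eLpNorm (fun ξ : Space d => ‖ε • ξ‖ ^ (κ + 1) • angularFourier (ψ ε) ξ) 2 volume) < ⊤)
    (l : Filter ℝ) [l.IsCountablyGenerated] (hl : l ≤ 𝓝[>] 0)
    (β w : Measure (Space d × Space d)) [IsFiniteMeasure β] [IsFiniteMeasure w]
    (hβ : TendstoWeakStar (fun ε => bohmMeasure ε (ψ ε) (Dψ ε)) l β)
    (hw : TendstoTempered (fun ε => wignerFun ε (ψ ε)) l w)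
    (hwβ : w = β) :
    ∃ R : ℝ → Space d → Space d,
      (∀ ε ∈ Ioc (0 : ℝ) 1,
        HasWeakGrad (fun x => √(posDensity (ψ ε) x)) (R ε) ∧ MemLp (R ε) 2 volume) ∧
      Tendsto (fun ε => eLpNorm (fun x => ε • R ε x) 2 volume) l (𝓝 0) := by
  classical
  subst hwβ
  set C₀ := ⨆ ε ∈ Ioc (0 : ℝ) 1, H1epsNorm ε (ψ ε) (Dψ ε) with hC₀
  have hC₀le : ∀ ε ∈ Ioc (0 : ℝ) 1, H1epsNorm ε (ψ ε) (Dψ ε) ≤ C₀ := fun ε hε =>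
    le_iSup₂ (f := fun (ε : ℝ) (_ : ε ∈ Ioc (0 : ℝ) 1) => H1epsNorm ε (ψ ε) (Dψ ε)) ε hε
  have hψle : ∀ ε ∈ Ioc (0 : ℝ) 1, eLpNorm (ψ ε) 2 volume ≤ C₀ := fun ε hε =>
    le_self_add.trans (hC₀le ε hε)
  have hDle : ∀ ε ∈ Ioc (0 : ℝ) 1, eLpNorm (fun x => ε • Dψ ε x) 2 volume ≤ C₀ := fun ε hε =>
    le_add_self.trans (hC₀le ε hε)
  -- measurable representatives of the components of the gradient
  have hmem : ∀ ε ∈ Ioc (0 : ℝ) 1, ∀ j, MemLp (fun x => Dψ ε x j) 2 volume := by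
    intro ε hε j
    have hm := (hD ε hε).locallyIntegrable_grad.aestronglyMeasurable
    have h1 : MemLp (fun x => ε • Dψ ε x) 2 volume :=
      ⟨hm.const_smul ε, (hDle ε hε).trans_lt hH1⟩
    have h2 : MemLp (Dψ ε) 2 volume := by
      have := h1.const_smul ε⁻¹
      refine (memLp_congr_ae (Eventually.of_forall fun x => ?_)).1 this
      simp [smul_smul, hε.1.ne']
    refine h2.of_le ((EuclideanSpace.proj j :
      EuclideanSpace ℂ (Fin d) →L[ℂ] ℂ).continuous.comp_aestronglyMeasurable hm)
      (Eventually.of_forall fun x => ?_)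
    exact PiLp.norm_apply_le (Dψ ε x) j
  let g : Fin d → ℝ → Lp (α := Space d) ℂ 2 volume := fun j ε =>
    if h : MemLp (fun x => Dψ ε x j) 2 volume then h.toLp _ else 0
  have hgae : ∀ ε ∈ Ioc (0 : ℝ) 1, ∀ j, g j ε =ᵐ[volume] fun x => Dψ ε x j := by
    intro ε hε j
    simp only [g, dif_pos (hmem ε hε j)]
    exact (hmem ε hε j).coeFn_toLp
  have hpart : ∀ j, ∀ ε ∈ Ioc (0 : ℝ) 1, HasWeakPartial j (ψ ε) (g j ε) := by
    intro j ε hε φ hφ hc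
    rw [(hD ε hε).integral_eq j φ hφ hc]
    congr 1
    refine integral_congr_ae ?_
    filter_upwards [hgae ε hε j] with x hx
    rw [hx]
  -- the weak gradient of the modulus
  let R : ℝ → Space d → Space d := fun ε x =>
    WithLp.toLp 2 fun j => (inner ℝ (‖ψ ε x‖⁻¹ • ψ ε x) (g j ε x) : ℝ)
  have hRm : ∀ ε, StronglyMeasurable (R ε) := by
    intro ε
    have h1 : Measurable fun x => fun j => (inner ℝ (‖ψ ε x‖⁻¹ • ψ ε x) (g j ε x) : ℝ) := by
      refine measurable_pi_lambda _ fun j => ?_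
      have hψm := Lp.stronglyMeasurable (ψ ε)
      exact ((hψm.norm.measurable.inv.stronglyMeasurable.smul hψm).inner
        (Lp.stronglyMeasurable (g j ε))).measurable
    exact ((WithLp.measurable_toLp 2 _).comp h1).stronglyMeasurable
  -- the integrated energy splitting
  have hsplit : ∀ ε ∈ Ioc (0 : ℝ) 1, (∫⁻ x, ‖ε • R ε x‖ₑ ^ 2) +
      ∫⁻ z, ‖z.2‖ₑ ^ 2 ∂(bohmMeasure ε (ψ ε) (Dψ ε)) ≤ ∑ j, ∫⁻ x, ‖ε • g j ε x‖ₑ ^ 2 := by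
    intro ε hε
    calc _ ≤ (∫⁻ x, ‖ε • R ε x‖ₑ ^ 2) + ∫⁻ x, ENNReal.ofReal (‖ψ ε x‖ ^ 2) *
          ‖(‖ψ ε x‖ ^ 2)⁻¹ • currentDensity ε (ψ ε) (Dψ ε) x‖ₑ ^ 2 :=
        add_le_add le_rfl (lintegral_bohmMeasure_le (Lp.stronglyMeasurable (ψ ε)) _)
      _ ≤ ∫⁻ x, (‖ε • R ε x‖ₑ ^ 2 + ENNReal.ofReal (‖ψ ε x‖ ^ 2) *
          ‖(‖ψ ε x‖ ^ 2)⁻¹ • currentDensity ε (ψ ε) (Dψ ε) x‖ₑ ^ 2) := le_lintegral_add _ _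
      _ ≤ ∫⁻ x, ∑ j, ‖ε • g j ε x‖ₑ ^ 2 := by
        refine lintegral_mono_ae ?_
        filter_upwards [ae_all_iff.2 (hgae ε hε)] with x hx
        have h := modulus_add_current_le ε (ψ ε x) (Dψ ε x)
        simp only [R, currentDensity, hx]
        exact h
      _ = _ := lintegral_finsetSum _ fun j _ =>
        (((Lp.stronglyMeasurable (g j ε)).const_smul ε).enorm.pow_const 2)
  have hE : ∀ ε ∈ Ioc (0 : ℝ) 1, ∑ j, ∫⁻ x, ‖ε • g j ε x‖ₑ ^ 2 ≤ C₀ ^ 2 := by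
    intro ε hε
    have hm : ∀ j ∈ Finset.univ, Measurable fun x => ‖ε • g j ε x‖ₑ ^ 2 := fun j _ =>
      (((Lp.stronglyMeasurable (g j ε)).const_smul ε).enorm.pow_const 2)
    rw [← lintegral_finsetSum _ hm]
    calc _ = ∫⁻ x, ‖ε • Dψ ε x‖ₑ ^ 2 := by
          refine lintegral_congr_ae ?_
          filter_upwards [ae_all_iff.2 (hgae ε hε)] with x hx
          simp only [hx, enorm_sq_eq_sum, PiLp.smul_apply]
      _ = eLpNorm (fun x => ε • Dψ ε x) 2 volume ^ 2 := (eLpNorm_two_sq _ _).symm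
      _ ≤ C₀ ^ 2 := by gcongr; exact hDle ε hε
  have hC₀2 : C₀ ^ 2 ≠ ⊤ := ENNReal.pow_ne_top hH1.ne
  refine ⟨R, fun ε hε => ?_, ?_⟩
  · have hRmem : MemLp (R ε) 2 volume := by
      have h1 : MemLp (fun x => ε • R ε x) 2 volume := by
        refine (memLp_two_iff_lintegral ((hRm ε).const_smul ε).aestronglyMeasurable).2 ?_
        exact (le_self_add.trans ((hsplit ε hε).trans (hE ε hε))).trans_lt hC₀2.lt_top
      refine (memLp_congr_ae (Eventually.of_forall fun x => ?_)).1 (h1.const_smul ε⁻¹)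
      simp [smul_smul, hε.1.ne']
    have hsqrt : (fun x => √(posDensity (ψ ε) x)) = fun x => ‖ψ ε x‖ := by
      ext x
      exact Real.sqrt_sq (norm_nonneg _)
    rw [hsqrt]
    refine ⟨⟨?_, hRmem.locallyIntegrable (by norm_num), fun j φ hφ hc => ?_⟩, hRmem⟩
    · exact (Lp.memLp (ψ ε)).norm.locallyIntegrable (by norm_num)
    · exact (hpart j ε hε).norm (Lp.stronglyMeasurable _) (Lp.stronglyMeasurable _)
        (Lp.memLp _) (Lp.memLp _) φ hφ hc
  · rcases eq_or_neBot l with rfl | hne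
    · exact tendsto_bot
    have hI : Ioc (0 : ℝ) 1 ∈ 𝓝[>] (0 : ℝ) := Ioc_mem_nhdsGT one_pos
    set W := ∫⁻ z : Space d × Space d, ‖z.2‖ₑ ^ 2 ∂w with hW
    -- lower semicontinuity and the energy bound make the second moment of the limit finite
    have hWle : W ≤ C₀ ^ 2 := by
      by_contra! hlt
      obtain ⟨ε, h1, h2⟩ := ((hβ.eventually_lt_lintegral hlt).and (hl hI)).exists
      exact absurd (le_add_self.trans ((hsplit ε h2).trans (hE ε h2))) (not_le.2 h1)
    have hWtop : W ≠ ⊤ := ne_top_of_le_ne_top hC₀2 hWle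
    have hmeas : ∀ j, Measurable fun z : Space d × Space d => ‖z.2 j‖ₑ ^ 2 := fun j => by
      fun_prop
    have hWsum : W = ∑ j, ∫⁻ z : Space d × Space d, ‖z.2 j‖ₑ ^ 2 ∂w := by
      rw [hW, ← lintegral_finsetSum _ fun j _ => hmeas j]
      simp only [enorm_sq_eq_sum]
    have henorm : ∀ (j : Fin d) (z : Space d × Space d),
        ENNReal.ofReal (‖z.2 j‖ ^ 2) = ‖z.2 j‖ₑ ^ 2 := fun j z => by
      rw [ENNReal.ofReal_pow (norm_nonneg _), ofReal_norm]
    have hint : ∀ j, Integrable (fun z : Space d × Space d => ‖z.2 j‖ ^ 2) w := by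
      intro j
      have hc : Continuous fun z : Space d × Space d => ‖z.2 j‖ ^ 2 := by fun_prop
      refine ⟨hc.aestronglyMeasurable, ?_⟩
      rw [hasFiniteIntegral_iff_ofReal (Eventually.of_forall fun _ => by positivity)]
      simp only [henorm]
      refine lt_of_le_of_lt ?_ hWtop.lt_top
      rw [hWsum]
      exact Finset.single_le_sum (f := fun j => ∫⁻ z : Space d × Space d, ‖z.2 j‖ₑ ^ 2 ∂w)
        (fun _ _ => zero_le) (Finset.mem_univ j)
    have hofReal : ∀ j, ENNReal.ofReal (∫ z : Space d × Space d, ‖z.2 j‖ ^ 2 ∂w) =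
        ∫⁻ z : Space d × Space d, ‖z.2 j‖ₑ ^ 2 ∂w := by
      intro j
      rw [ofReal_integral_eq_lintegral_ofReal (hint j) (Eventually.of_forall fun _ => by positivity)]
      simp only [henorm]
    have hcptj : ∀ j, CompactAtInfinity fun ε x => ε • g j ε x := by
      intro j
      refine tendsto_of_tendsto_of_tendsto_of_le_of_le tendsto_const_nhds hcpt
        (fun _ => zero_le) fun r => ?_
      refine limsup_le_limsup ?_
      filter_upwards [hI] with ε hε
      refine lintegral_mono_ae (ae_restrict_of_ae ?_)
      filter_upwards [hgae ε hε j] with x hx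
      rw [hx, enorm_sq_eq_sum (ε • Dψ ε x)]
      exact Finset.single_le_sum (f := fun j => ‖(ε • Dψ ε x) j‖ₑ ^ 2)
        (fun _ _ => zero_le) (Finset.mem_univ j)
    have hupper : ∀ δ : ℝ, 0 < δ →
        ∀ᶠ ε in l, ∑ j, ∫⁻ x, ‖ε • g j ε x‖ₑ ^ 2 ≤ W + d * ENNReal.ofReal δ := by
      intro δ hδ
      have h : ∀ j, ∀ᶠ ε in l, ∫⁻ x, ‖ε • g j ε x‖ₑ ^ 2 ≤
          ENNReal.ofReal ((∫ z : Space d × Space d, ‖z.2 j‖ ^ 2 ∂w) + δ) := fun j =>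
        eventually_lintegral_deriv_sq_le ψ (g j) (hpart j) hH1.ne hosc.ne hψle hκ
          (fun ε hε => le_iSup₂ (f := fun (ε : ℝ) (_ : ε ∈ Ioc (0 : ℝ) 1) => eLpNorm
            (fun ξ : Space d => ‖ε • ξ‖ ^ (κ + 1) • angularFourier (ψ ε) ξ) 2 volume) ε hε)
          (hcptj j) hl hw (hint j) hδ
      filter_upwards [eventually_all.2 h] with ε hε
      refine (Finset.sum_le_sum fun j _ => hε j).trans_eq ?_
      simp_rw [ENNReal.ofReal_add (integral_nonneg fun _ => sq_nonneg _) hδ.le, hofReal]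
      rw [Finset.sum_add_distrib, ← hWsum]
      simp
    have hsq : Tendsto (fun ε => ∫⁻ x, ‖ε • R ε x‖ₑ ^ 2) l (𝓝 0) := by
      rw [ENNReal.tendsto_nhds_zero]
      intro η hη
      obtain ⟨δ, hδ, hδη⟩ : ∃ δ : ℝ, 0 < δ ∧ (d + 1) * ENNReal.ofReal δ ≤ η := by
        have hcont : Tendsto (fun δ : ℝ => (d + 1 : ℝ≥0∞) * ENNReal.ofReal δ) (𝓝[>] 0) (𝓝 0) := by
          have h := ENNReal.Tendsto.const_mul (a := (d + 1 : ℝ≥0∞))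
            (ENNReal.continuous_ofReal.tendsto 0) (Or.inr (by finiteness))
          rw [ENNReal.ofReal_zero, mul_zero] at h
          exact h.mono_left nhdsWithin_le_nhds
        obtain ⟨δ, h1, h2⟩ := ((hcont.eventually_le_const hη).and
          (self_mem_nhdsWithin : Ioi (0 : ℝ) ∈ 𝓝[>] 0)).exists
        exact ⟨δ, h2, h1⟩
      have hlower : ∀ᶠ ε in l,
          W ≤ (∫⁻ z, ‖z.2‖ₑ ^ 2 ∂(bohmMeasure ε (ψ ε) (Dψ ε))) + ENNReal.ofReal δ := by
        rcases eq_or_ne W 0 with h0 | h0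
        · simp [h0]
        · filter_upwards [hβ.eventually_lt_lintegral
            (ENNReal.sub_lt_self hWtop h0 (ENNReal.ofReal_pos.2 hδ).ne')] with ε hε
          exact tsub_le_iff_right.1 hε.le
      filter_upwards [hupper δ hδ, hlower, hl hI] with ε h1 h2 h3
      set B := ∫⁻ z, ‖z.2‖ₑ ^ 2 ∂(bohmMeasure ε (ψ ε) (Dψ ε)) with hB
      have hBtop : B ≠ ⊤ :=
        ne_top_of_le_ne_top hC₀2 (le_add_self.trans ((hsplit ε h3).trans (hE ε h3)))
      refine le_trans ?_ hδη
      refine (ENNReal.add_le_add_iff_right hBtop).1 ?_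
      calc _ ≤ W + d * ENNReal.ofReal δ := (hsplit ε h3).trans h1
        _ ≤ B + ENNReal.ofReal δ + d * ENNReal.ofReal δ := by gcongr
        _ = _ := by ring
    exact tendsto_eLpNorm_two_zero hsq
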